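/- **Theorem (Block structure of the transformed Hamiltonian).** *Setting.* All Hamiltonians and amplitudes are real. Let $L,R$ be finite sets and $n_i\ge 1$ for $i\in L$. The vertices are those of disjoint cliques $C_i$ ($i\in L$, $|C_i|=n_i$) together with the pairwise non-adjacent vertices $j\in R$. The driver graph $G_{\rm driver}$ is the disjoint union of the cliques. In $G_{\rm dis}$ every clique vertex is adjacent to every $j\in R$; in $G_{\rm share}$ one vertex $s_i\in C_i$ is fixed for each $i$, and every vertex of $C_i$ except $s_i$ is adjacent to every $j\in R$. Let $\tilde n=\frac{I+\sigma^z}{2}=|1\rangle\langle 1|$, $S^x=\frac12\sigma^x$, and for real $w_i$ ($i\in L$; the weight of every vertex of $C_i$), $w_j$ ($j\in R$), $J_{zz}^{\rm clique}$, $J_{zz}$, $\mathtt x$, $\mathtt{jxx}$ let $$H_1=-\mathtt x\sum_v S^x_v+\mathtt{jxx}\!\!\sum_{uv\in E(G_{\rm driver})}\!\! S^x_uS^x_v-\sum_v w_v\tilde n_v+J_{zz}^{\rm clique}\!\!\sum_{uv\in E(G_{\rm driver})}\!\!\tilde n_u\tilde n_v+J_{zz}\!\!\sum_{uv\in E(G)\setminus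 E(G_{\rm driver})}\!\!\tilde n_u\tilde n_v .$$ Let $\Pi_-$ be the projector onto the span of the computational states with at most one occupied vertex in each clique, and $H_1^{\rm eff}=\Pi_-H_1\Pi_-$. *Angular-momentum basis.* For clique $C_i$ take $|1_c\rangle=n_i^{-1/2}\sum_{a}|a\rangle$ (uniform superposition of the singletons), $|0_c\rangle=|\emptyset\rangle$ (these two form an effective spin $\frac12$), and $n_i-1$ "spin-0" states, an orthonormal basis of the orthogonal complement of $|1_c\rangle$ in the span of the singletons: an arbitrary one for $G_{\rm dis}$, and for $G_{\rm share}$ one whose first member is $|\odot_q\rangle=-\sqrt{\tfrac1{n_i}}\,\tfrac{1}{\sqrt{n_i-1}}\sum_{a\ne s_i}|a\rangle+\sqrt{\tfrac{n_i-1}{n_i}}\,|s_i\rangle$ (if $n_i\ge2$). $\mathcal B_{\rm ang}$ consists of the tensor products of these states and of the computational states on $R$. A sector is obtained by choosing in each clique either the spin $\frac12$ or one spin-0 state, tensored with $(\mathbb R^2)^{\otimes R}$. The same-sign sector $\mathcal C$ has spin $\frac12$ in every clique. $\mathcal Q$ denotes a sector with a spin-0 state in every clique: any such sector for $G_{\rm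 dis}$, and the one with $|\odot_q\rangle$ in every clique for $G_{\rm share}$. Let $U$ be the matrix whose columns are the states of $\mathcal B_{\rm ang}$, and $\bar H=U^{T}H_1^{\rm eff}U$. Let $$B(w,x)=\begin{pmatrix}-w&-\frac x2\\-\frac x2&0\end{pmatrix}$$ in the ordered basis $|1\rangle,|0\rangle$; subscripts indicate the tensor factor on which an operator acts. *Claim.* 1. $\mathcal B_{\rm ang}$ is an orthonormal basis of the range of $\Pi_-$. Its members in $\mathcal C$ have only non-negative amplitudes in the computational basis; each member in any other sector has both positive and negative amplitudes. 2. For all $\mathtt x,\mathtt{jxx}$, $\bar H=\big(H_{\mathcal C}\oplus\cdots\oplus H_{\mathcal Q}\big)+H_{\rm inter\text{-}block}$, the direct sum being over all sectors (the intermediate sectors included), where $H_{\rm inter\text{-}block}=0$ for $G_{\rm dis}$ and $$H_{\rm inter\text{-}block}=J_{zz}\sum_{(i,j)\in L\times R}\frac{\sqrt{n_i-1}}{n_i}\,T^{cq}_i\,\tilde n_j\quad\text{for }G_{\rm share},\qquad T^{cq}=\begin{pmatrix}0&0&-1\\0&0&0\\-1&0&0\end{pmatrix}$$ in the ordered basis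 $|1_c\rangle,|0_c\rangle,|\odot_q\rangle$ ($T^{cq}$ vanishes on the other spin-0 states). It has no entries inside a block and does not depend on $\mathtt x$. Moreover $$H_{\mathcal C}=\sum_{i\in L}B_i\big(w_i^{\rm eff},\sqrt{n_i}\,\mathtt x\big)+\sum_{j\in R}B_j(w_j,\mathtt x)+J_{zz}\sum_{(i,j)\in L\times R}f_i^C\,\tilde n_i\tilde n_j,$$ $$H_{\mathcal Q}=-\sum_{i\in L}\big(w_i+\tfrac14\mathtt{jxx}\big)+\sum_{j\in R}B_j\Big(w_j-J_{zz}\sum_{i\in L}f_i^Q,\ \mathtt x\Big),$$ with $w_i^{\rm eff}=w_i-\frac{n_i-1}4\mathtt{jxx}$, $f_i^C=f_i^Q=1$ for $G_{\rm dis}$, and $f_i^C=\frac{n_i-1}{n_i}$, $f_i^Q=\frac1{n_i}$ for $G_{\rm share}$. 3. At the beginning of Stage 1, where $\mathtt x=\Gamma_1$ and $\mathtt{jxx}=J_{xx}$, the ground state resides in the same-sign sector for large $\Gamma_1$ (all other parameters being fixed). For $G_{\rm dis}$ and all sufficiently large $\Gamma_1$, every ground state of $\bar H$ lies in $\mathcal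 C$. For both graphs and every $\varepsilon>0$, for all sufficiently large $\Gamma_1$, every normalized ground state of $\bar H$ has squared norm at most $\varepsilon$ outside $\mathcal C$. -/

import Mathlib

open Matrix Filter
open scoped Kronecker

noncomputable section

/-! All Hamiltonians below are real symmetric, and states have real amplitudes.
A two-level system (a spin one half) has the basis `true = |1⟩` (occupied), `false = |0⟩` (empty). -/

/-! ### One-site matrices and their tensor embeddings -/

/-- The Pauli matrix `σˣ`. -/
def pauliX : Matrix Bool Bool ℝ := fun a b => if a = b then 0 else 1

/-- The Pauli matrix `σᶻ`, with eigenvalue `1` on `|1⟩` and `-1` on `|0⟩`. -/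
def pauliZ : Matrix Bool Bool ℝ := Matrix.diagonal (fun a => if a then 1 else -1)

/-- The spin operator `Sˣ = σˣ / 2`. -/
def spinX : Matrix Bool Bool ℝ := (1 / 2 : ℝ) • pauliX

/-- The shifted `σᶻ` operator `(I + σᶻ) / 2`, with eigenvalues `0` and `1`. -/
def shiftedZ : Matrix Bool Bool ℝ := (1 / 2 : ℝ) • (1 + pauliZ)

/-- The two-level Hamiltonian `B(w, x)`, with rows `(-w, -x/2)` and `(-x/2, 0)`
in the ordered basis `|1⟩, |0⟩`. -/
def twoLevel (w x : ℝ) : Matrix Bool Bool ℝ := fun a b =>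
  match a, b with
  | true, true => -w
  | true, false => -(1 / 2) * x
  | false, true => -(1 / 2) * x
  | false, false => 0

open Classical in
/-- The operator `I ⊗ ⋯ ⊗ A ⊗ ⋯ ⊗ I` on a tensor product of spaces with bases `α u`,
with `A` acting on the factor `i`. -/
def localOp {ι : Type*} {α : ι → Type*} (i : ι) (A : Matrix (α i) (α i) ℝ) :
    Matrix (∀ u, α u) (∀ u, α u) ℝ :=
  fun c d => if ∀ u, u ≠ i → c u = d u then A (c i) (d i) else 0

/-! ### The graphs -/

/-- The vertices: clique `i ∈ L` has the vertices `⟨i, a⟩`, `a : Fin (n i)`; the other vertices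
are those of `R`. -/
abbrev Vertex {L : Type*} (n : L → ℕ) (R : Type*) : Type _ := (Σ i : L, Fin (n i)) ⊕ R

/-- The disjoint structure, or the shared structure in which the vertex `s i` of clique `i` is the
one that is not adjacent to `R`. -/
inductive StructureKind {L : Type*} (n : L → ℕ) : Type _
  | dis : StructureKind n
  | share (s : ∀ i, Fin (n i)) : StructureKind n

/-- Whether the vertex `a` of clique `i` is adjacent to the vertices of `R`. -/
def StructureKind.Coupled {L : Type*} {n : L → ℕ} (K : StructureKind n) (i : L) (a : Fin (n i)) :
    Prop :=
  match K with
  | .dis => True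
  | .share s => a ≠ s i

/-- The `XX`-driver graph: the disjoint union of the cliques of `L`. -/
def driverGraph {L : Type*} (n : L → ℕ) (R : Type*) : SimpleGraph (Vertex n R) :=
  SimpleGraph.fromRel fun u v => ∃ i a b, u = Sum.inl ⟨i, a⟩ ∧ v = Sum.inl ⟨i, b⟩

/-- The problem graph: the disjoint-structure graph or the shared-structure graph. -/
def problemGraph {L : Type*} {n : L → ℕ} (R : Type*) (K : StructureKind n) :
    SimpleGraph (Vertex n R) :=
  driverGraph n R ⊔
    SimpleGraph.fromRel fun u v => ∃ i a j, K.Coupled i a ∧ u = Sum.inl ⟨i, a⟩ ∧ v = Sum.inr j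

/-! ### The system Hamiltonian on the full space, with basis `V → Bool` -/

open Classical in
/-- The sum of `f u v` over the edges `uv` of `G`, for a symmetric `f`
(the double sum meets every edge twice). -/
def edgeSum {V : Type*} [Fintype V] {M : Type*} [AddCommMonoid M] [Module ℝ M]
    (G : SimpleGraph V) (f : V → V → M) : M :=
  (1 / 2 : ℝ) • ∑ u, ∑ v, if G.Adj u v then f u v else 0

section Hamiltonian

variable {L R : Type*} [Fintype L] [DecidableEq L] [Fintype R] [DecidableEq R] {n : L → ℕ}

/-- The weight of a vertex: `wL i` for all vertices of clique `i`, and `wR j` for `j ∈ R`. -/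
def vertexWeight (wL : L → ℝ) (wR : R → ℝ) : Vertex n R → ℝ
  | Sum.inl v => wL v.1
  | Sum.inr j => wR j

/-- The transverse-field term `-∑ Sˣ_v`. -/
def transverseH (n : L → ℕ) (R : Type*) [Fintype R] :
    Matrix (Vertex n R → Bool) (Vertex n R → Bool) ℝ :=
  -∑ v : Vertex n R, localOp v spinX

/-- The `XX`-driver term `∑ Sˣ_u Sˣ_v` over the edges of the driver graph. -/
def driverH (n : L → ℕ) (R : Type*) [Fintype R] [DecidableEq R] :
    Matrix (Vertex n R → Bool) (Vertex n R → Bool) ℝ :=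
  edgeSum (driverGraph n R) fun u v => localOp u spinX * localOp v spinX

/-- The MIS-Ising problem Hamiltonian, with coupling `Jclique` on the driver edges and `Jzz` on
all other edges. -/
def problemH (K : StructureKind n) (wL : L → ℝ) (wR : R → ℝ) (Jclique Jzz : ℝ) :
    Matrix (Vertex n R → Bool) (Vertex n R → Bool) ℝ :=
  (∑ v : Vertex n R, (-vertexWeight wL wR v) • localOp v shiftedZ)
    + Jclique • edgeSum (driverGraph n R) (fun u v => localOp u shiftedZ * localOp v shiftedZ)
    + Jzz • edgeSum (problemGraph R K \ driverGraph n R)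
        (fun u v => localOp u shiftedZ * localOp v shiftedZ)

/-- The system Hamiltonian `H₁ = x H_X + jxx H_XX + H_problem`. -/
def systemH (K : StructureKind n) (wL : L → ℝ) (wR : R → ℝ) (Jclique Jzz x jxx : ℝ) :
    Matrix (Vertex n R → Bool) (Vertex n R → Bool) ℝ :=
  x • transverseH n R + jxx • driverH n R + problemH K wL wR Jclique Jzz

open Classical in
/-- The projector `Π₋` onto the low-energy subspace, spanned by the basis states whose occupied
vertices contain no edge of a clique (the state on `R` is arbitrary). -/
def lowProjector (n : L → ℕ) (R : Type*) [Fintype R] [DecidableEq R] :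
    Matrix (Vertex n R → Bool) (Vertex n R → Bool) ℝ :=
  Matrix.diagonal fun c =>
    if ∀ u v, (driverGraph n R).Adj u v → ¬(c u = true ∧ c v = true) then 1 else 0

/-- The effective Hamiltonian `Π₋ H₁ Π₋`. -/
def effectiveH (K : StructureKind n) (wL : L → ℝ) (wR : R → ℝ) (Jclique Jzz x jxx : ℝ) :
    Matrix (Vertex n R → Bool) (Vertex n R → Bool) ℝ :=
  lowProjector n R * systemH K wL wR Jclique Jzz x jxx * lowProjector n R

end Hamiltonian

/-! ### The angular-momentum basis -/

/-- Amplitudes, on the singleton states of a clique of size `n`, of the `n - 1` spin-zero states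
`|k, s-1, -(s-1)⟩`: an orthonormal basis of the complement of the uniform superposition. -/
structure SpinZeroFrame (n : ℕ) where
  amp : Fin (n - 1) → Fin n → ℝ
  sum_zero : ∀ k, ∑ a, amp k a = 0
  orthonormal : ∀ k l, ∑ a, amp k a * amp l a = if k = l then 1 else 0

/-- The frame comes from splitting the clique into the subclique without `s` and the vertex `s`:
the first spin-zero state is `-√(1/n) |1_a 0_b⟩ + √((n-1)/n) |0_a 1_b⟩`, where `|1_a⟩` is the
uniform superposition of the `n - 1` singleton states of the subclique and `b` is the vertex `s`.
(The other spin-zero states are then supported on the subclique.) -/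
def SpinZeroFrame.Adapted {n : ℕ} (F : SpinZeroFrame n) (s : Fin n) : Prop :=
  ∀ (h : 0 < n - 1) (a : Fin n), F.amp ⟨0, h⟩ a =
    if a = s then √(((n : ℝ) - 1) / n) else -√(1 / (n : ℝ)) * (1 / √((n : ℝ) - 1))

/-- The frames used for a structure: arbitrary ones in the disjoint case, those adapted to the
shared vertices in the shared case. -/
def StructureKind.Admits {L : Type*} {n : L → ℕ} (K : StructureKind n)
    (F : ∀ i, SpinZeroFrame (n i)) : Prop :=
  match K with
  | .dis => True
  | .share s => ∀ i, (F i).Adapted (s i)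

/-- Labels of the angular-momentum basis of a clique of size `n`: `inl true` and `inl false` are
the states `|1⟩` and `|0⟩` of the effective spin one half, `inr k` are the spin-zero states. -/
abbrev CliqueIndex (n : ℕ) : Type := Bool ⊕ Fin (n - 1)

open Classical in
/-- The superposition, with amplitudes `f`, of the singleton states of a clique. -/
def singletonState {n : ℕ} (f : Fin n → ℝ) (c : Fin n → Bool) : ℝ :=
  ∑ a, if c = (fun b => decide (b = a)) then f a else 0

/-- The basis transformation of one clique: its columns are the uniform superposition of the
singleton states, the empty state, and the spin-zero states. -/
def cliqueU {n : ℕ} (F : SpinZeroFrame n) : Matrix (Fin n → Bool) (CliqueIndex n) ℝ :=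
  fun c p =>
    match p with
    | Sum.inl true => singletonState (fun _ => 1 / √(n : ℝ)) c
    | Sum.inl false => if c = (fun _ => false) then 1 else 0
    | Sum.inr k => singletonState (F.amp k) c

/-- Labels of the angular-momentum basis of the whole low-energy space. -/
abbrev AngIndex {L : Type*} (n : L → ℕ) (R : Type*) : Type _ :=
  (∀ i : L, CliqueIndex (n i)) × (R → Bool)

section Angular

variable {L R : Type*} [Fintype L] [DecidableEq L] [Fintype R] [DecidableEq R] {n : L → ℕ}

/-- The global basis transformation, the tensor product of those of the cliques and of the identity
on `R`; its columns are the states of the angular-momentum basis. -/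
def angU (R : Type*) [Fintype R] [DecidableEq R] (F : ∀ i, SpinZeroFrame (n i)) : Matrix (Vertex n R → Bool) (AngIndex n R) ℝ :=
  fun c p => (∏ i, cliqueU (F i) (fun a => c (Sum.inl ⟨i, a⟩)) (p.1 i)) *
    (if (fun j => c (Sum.inr j)) = p.2 then 1 else 0)

/-- The effective Hamiltonian in the angular-momentum basis. -/
def angH (F : ∀ i, SpinZeroFrame (n i)) (K : StructureKind n) (wL : L → ℝ) (wR : R → ℝ)
    (Jclique Jzz x jxx : ℝ) : Matrix (AngIndex n R) (AngIndex n R) ℝ :=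
  (angU R F)ᵀ * effectiveH K wL wR Jclique Jzz x jxx * angU R F

/-! ### Sectors -/

/-- The sector of a clique basis state: `none` for the effective spin one half, and one
one-dimensional sector `some k` for each spin-zero state. -/
def cliqueSector {m : ℕ} : CliqueIndex m → Option (Fin (m - 1))
  | Sum.inl _ => none
  | Sum.inr k => some k

/-- The sector (block) of a basis state: a choice of a sector in every clique. -/
def sector (p : AngIndex n R) : ∀ i, Option (Fin (n i - 1)) := fun i => cliqueSector (p.1 i)

/-- The same-sign sector `𝒞`: the effective spin one half in every clique. -/
def sectorC (n : L → ℕ) : ∀ i, Option (Fin (n i - 1)) := fun _ => none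

/-- The basis states of the same-sign sector. -/
def embC (n : L → ℕ) (R : Type*) : (L → Bool) × (R → Bool) → AngIndex n R :=
  fun z => (fun i => Sum.inl (z.1 i), z.2)

/-- The basis states of the all-spin-zero sector with the spin-zero state `k i` in clique `i`. -/
def embQ (R : Type*) (k : ∀ i, Fin (n i - 1)) : (R → Bool) → AngIndex n R :=
  fun b => (fun i => Sum.inr (k i), b)

/-- The all-spin-zero sectors whose block is called `H_𝒬`: all of them in the disjoint case; in the
shared case the one with the first spin-zero state in every clique. -/
def StructureKind.IsQ (K : StructureKind n) (k : ∀ i, Fin (n i - 1)) : Prop :=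
  match K with
  | .dis => True
  | .share _ => ∀ i, (k i : ℕ) = 0

/-- `D` is a direct sum of blocks, one for every sector. -/
def IsBlockDiagonal (D : Matrix (AngIndex n R) (AngIndex n R) ℝ) : Prop :=
  ∀ p q, sector p ≠ sector q → D p q = 0

/-! ### The blocks and the inter-block term -/

/-- The coefficient `f_i^C`. -/
def coeffC (K : StructureKind n) (i : L) : ℝ :=
  match K with
  | .dis => 1
  | .share _ => ((n i : ℝ) - 1) / n i

/-- The coefficient `f_i^Q`. -/
def coeffQ (K : StructureKind n) (i : L) : ℝ :=
  match K with
  | .dis => 1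
  | .share _ => 1 / (n i : ℝ)

/-- The effective weight `w_i - (n_i - 1) jxx / 4`. -/
def effWeight (n : L → ℕ) (wL : L → ℝ) (jxx : ℝ) (i : L) : ℝ :=
  wL i - ((n i : ℝ) - 1) / 4 * jxx

/-- The same-sign block `H_𝒞`. -/
def blockC (K : StructureKind n) (wL : L → ℝ) (wR : R → ℝ) (Jzz x jxx : ℝ) :
    Matrix ((L → Bool) × (R → Bool)) ((L → Bool) × (R → Bool)) ℝ :=
  (∑ i, localOp (α := fun _ : L => Bool) i (twoLevel (effWeight n wL jxx i) (√(n i : ℝ) * x))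
      ⊗ₖ (1 : Matrix (R → Bool) (R → Bool) ℝ))
    + (∑ j, (1 : Matrix (L → Bool) (L → Bool) ℝ)
      ⊗ₖ localOp (α := fun _ : R => Bool) j (twoLevel (wR j) x))
    + Jzz • ∑ i, ∑ j, coeffC K i •
        (localOp (α := fun _ : L => Bool) i shiftedZ ⊗ₖ localOp (α := fun _ : R => Bool) j shiftedZ)

/-- The all-spin-zero block `H_𝒬`. -/
def blockQ (K : StructureKind n) (wL : L → ℝ) (wR : R → ℝ) (Jzz x jxx : ℝ) :
    Matrix (R → Bool) (R → Bool) ℝ :=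
  (-∑ i, (wL i + 1 / 4 * jxx)) • (1 : Matrix (R → Bool) (R → Bool) ℝ)
    + ∑ j, localOp (α := fun _ : R => Bool) j (twoLevel (wR j - Jzz * ∑ i, coeffQ K i) x)

/-- The operator `T^cq` of one clique: in the ordered basis formed by `|1⟩`, `|0⟩` and the first
spin-zero state it has the entry `-1` in the two corners off the diagonal and `0` elsewhere; it
vanishes on the other spin-zero states. -/
def cqOp (m : ℕ) : Matrix (CliqueIndex m) (CliqueIndex m) ℝ := fun p q =>
  match p, q with
  | Sum.inl true, Sum.inr k => if (k : ℕ) = 0 then -1 else 0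
  | Sum.inr k, Sum.inl true => if (k : ℕ) = 0 then -1 else 0
  | _, _ => 0

/-- The inter-block term: zero in the disjoint case, and
`Jzz ∑ (√(n_i - 1) / n_i) T^cq_i ñ_j` in the shared case. -/
def interBlock (R : Type*) [Fintype R] [DecidableEq R] (K : StructureKind n) (Jzz : ℝ) :
    Matrix (AngIndex n R) (AngIndex n R) ℝ :=
  match K with
  | .dis => 0
  | .share _ => Jzz • ∑ i, ∑ j, (√((n i : ℝ) - 1) / n i) •
      (localOp (α := fun i : L => CliqueIndex (n i)) i (cqOp (n i))
        ⊗ₖ localOp (α := fun _ : R => Bool) j shiftedZ)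

end Angular

/-! ### States -/

/-- All amplitudes are non-negative. -/
def IsSameSign {ι : Type*} (ψ : ι → ℝ) : Prop := ∀ c, 0 ≤ ψ c

/-- There are positive and negative amplitudes. -/
def IsOppositeSign {ι : Type*} (ψ : ι → ℝ) : Prop := ∃ c d, 0 < ψ c ∧ ψ d < 0

/-- `ψ` is an eigenvector of `H` whose eigenvalue is the least expectation value of `H`. -/
def IsGroundState {ι : Type*} [Fintype ι] (H : Matrix ι ι ℝ) (ψ : ι → ℝ) : Prop :=
  ψ ≠ 0 ∧ ∃ E : ℝ, H *ᵥ ψ = E • ψ ∧ ∀ φ : ι → ℝ, E * (φ ⬝ᵥ φ) ≤ φ ⬝ᵥ (H *ᵥ φ)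

end

/-!
The Hamiltonian is a sum of terms acting on one clique, on one vertex of `R`, or on a clique and a
vertex of `R`; on the tensor product of the clique spaces and of the spaces of `R` these are
operators `localOp i A ⊗ₖ B`. The angular-momentum basis is a tensor product of clique bases. Each
of them is an orthonormal basis of the low-energy space of its clique (`cliqueU_transpose_mul`,
`cliqueU_mul_transpose`), so the projector `Π₋` is absorbed by the basis change (`angH_eq`), and
conjugation acts factor by factor (`tensorMatrix_conj_localOp`). Everything then reduces to one
clique of size `m`, where the low-energy space is spanned by the empty configuration and the `m`
singletons:

* the transverse field connects the empty state to the uniform superposition only, with the factor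
  `√m` (`cliqueU_conj_spinX`);
* the `XX` term is `1/4` times the adjacency matrix of the complete graph on the singletons, with
  eigenvalue `(m - 1) / 4` on the uniform superposition and `-1/4` on its complement
  (`cliqueU_conj_pairSum_spinX`);
* the pair interaction vanishes, and the total occupation is the identity on the singletons
  (`cliqueU_conj_pairSum_shiftedZ`, `cliqueU_conj_sum_shiftedZ`);
* the occupation of all vertices but `s` is the total occupation minus the projector onto the
  singleton `s`, which has non-zero amplitudes only in the uniform superposition and the first
  spin-zero state of an adapted frame; the off-diagonal entry between these two is the inter-block
  term (`cliqueU_conj_shiftedZ_ne`).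

The signs of the basis states follow because the amplitudes of a spin-zero state add up to zero.

For a large transverse field `x`, the Hamiltonian is `x A + B` with `B` fixed. Up to non-negative
multiples of projectors onto the excited states of the effective spins and of the vertices of `R`,
`A` is diagonal (`angConj_transverseH_eq`); its lower bound is attained in the same-sign sector, and
every clique in a spin-zero state costs at least one half (`transverse_lower_bound`). Comparison
with a trial state in the same-sign sector bounds the weight of a ground state outside that sector
by a multiple of `1 / x` (`eventually_groundState_concentrates`). Without an inter-block term, the
part of a ground state outside the same-sign sector is again a ground state if it is not zero, which
contradicts this bound.
-/

noncomputable section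

set_option linter.unusedSectionVars false

/-! ### Tensor products of matrices -/

section Tensor

variable {ι : Type*} {α β γ : ι → Type*}

theorem localOp_transpose (i : ι) (A : Matrix (α i) (α i) ℝ) :
    (localOp i A)ᵀ = localOp i Aᵀ := by
  ext c d
  simp only [localOp, transpose_apply]
  congr 1
  simp only [eq_comm]

theorem localOp_diagonal [∀ i, DecidableEq (α i)] [DecidableEq (∀ i, α i)] (i : ι) (f : α i → ℝ) :
    localOp i (diagonal f) = diagonal fun c : ∀ u, α u => f (c i) := by
  ext c d
  simp only [localOp, diagonal_apply]
  by_cases h : c = d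
  · simp [h]
  · rw [if_neg h]
    split_ifs with h1 h2
    · refine absurd (funext fun u => ?_) h
      obtain rfl | hu := eq_or_ne u i
      exacts [h2, h1 u hu]
    · rfl
    · rfl

theorem localOp_add (i : ι) (A B : Matrix (α i) (α i) ℝ) :
    localOp i (A + B) = localOp i A + localOp i B := by
  ext c d
  simp only [localOp, Matrix.add_apply]
  split_ifs <;> simp

theorem localOp_smul (i : ι) (r : ℝ) (A : Matrix (α i) (α i) ℝ) :
    localOp i (r • A) = r • localOp i A := by
  ext c d
  simp only [localOp, Matrix.smul_apply]
  split_ifs <;> simp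

/-- `localOp i` as a linear map. -/
def localOpₗ (i : ι) : Matrix (α i) (α i) ℝ →ₗ[ℝ] Matrix (∀ u, α u) (∀ u, α u) ℝ where
  toFun := localOp i
  map_add' := localOp_add i
  map_smul' := localOp_smul i

theorem localOp_sum {κ : Type*} (t : Finset κ) (i : ι) (A : κ → Matrix (α i) (α i) ℝ) :
    localOp i (∑ k ∈ t, A k) = ∑ k ∈ t, localOp i (A k) := map_sum (localOpₗ i) A t

theorem localOp_neg (i : ι) (A : Matrix (α i) (α i) ℝ) :
    localOp i (-A) = -localOp i A := map_neg (localOpₗ i) A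

theorem localOp_zero (i : ι) :
    localOp i (0 : Matrix (α i) (α i) ℝ) = 0 := map_zero (localOpₗ i)

variable [Fintype ι]

/-- The tensor product of a family of matrices. -/
def tensorMatrix (V : ∀ i, Matrix (α i) (β i) ℝ) : Matrix (∀ i, α i) (∀ i, β i) ℝ :=
  fun c d => ∏ i, V i (c i) (d i)

theorem tensorMatrix_transpose (V : ∀ i, Matrix (α i) (β i) ℝ) :
    (tensorMatrix V)ᵀ = tensorMatrix fun i => (V i)ᵀ := rfl

theorem tensorMatrix_one [∀ i, DecidableEq (α i)] :
    tensorMatrix (fun i => (1 : Matrix (α i) (α i) ℝ)) = 1 := by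
  ext c d
  simp only [tensorMatrix, one_apply, Finset.prod_ite_zero, Finset.prod_const_one,
    Finset.mem_univ, true_imp_iff, funext_iff]

variable [DecidableEq ι]

theorem tensorMatrix_mul [∀ i, Fintype (β i)] (V : ∀ i, Matrix (α i) (β i) ℝ)
    (W : ∀ i, Matrix (β i) (γ i) ℝ) :
    tensorMatrix V * tensorMatrix W = tensorMatrix fun i => V i * W i := by
  ext c d
  simp only [tensorMatrix, mul_apply, Finset.prod_univ_sum, Fintype.piFinset_univ,
    Finset.prod_mul_distrib]

theorem localOp_eq_tensorMatrix [∀ i, DecidableEq (α i)] (i : ι) (A : Matrix (α i) (α i) ℝ) :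
    localOp i A = tensorMatrix (Function.update (fun u => (1 : Matrix (α u) (α u) ℝ)) i A) := by
  ext c d
  rw [tensorMatrix, ← Finset.mul_prod_erase _ _ (Finset.mem_univ i), localOp]
  have h : ∏ u ∈ Finset.univ.erase i,
      Function.update (fun u => (1 : Matrix (α u) (α u) ℝ)) i A u (c u) (d u)
      = ∏ u ∈ Finset.univ.erase i, if c u = d u then 1 else 0 := by
    refine Finset.prod_congr rfl fun u hu => ?_
    rw [Function.update_of_ne (Finset.ne_of_mem_erase hu), one_apply]
  rw [h, Finset.prod_ite_zero]
  simp

/-- Conjugating by a tensor product of isometries acts factor by factor. -/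
theorem tensorMatrix_conj_localOp [∀ i, Fintype (α i)] [∀ i, DecidableEq (α i)]
    [∀ i, Fintype (β i)] [∀ i, DecidableEq (β i)]
    (V : ∀ i, Matrix (α i) (β i) ℝ) (hV : ∀ i, (V i)ᵀ * V i = 1) (i : ι)
    (A : Matrix (α i) (α i) ℝ) :
    (tensorMatrix V)ᵀ * localOp i A * tensorMatrix V = localOp i ((V i)ᵀ * A * V i) := by
  rw [localOp_eq_tensorMatrix, localOp_eq_tensorMatrix, tensorMatrix_transpose, tensorMatrix_mul,
    tensorMatrix_mul]
  congr 1
  funext u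
  obtain rfl | h := eq_or_ne u i
  · simp
  · simp [Function.update_of_ne h, hV]

theorem localOp_mul [∀ i, Fintype (α i)] (i : ι) (A B : Matrix (α i) (α i) ℝ) :
    localOp i A * localOp i B = localOp i (A * B) := by
  classical
  simp only [localOp_eq_tensorMatrix, tensorMatrix_mul]
  congr 1
  funext u
  obtain rfl | h := eq_or_ne u i
  · simp
  · simp [Function.update_of_ne h]

theorem localOp_mul_of_ne [∀ i, Fintype (α i)] {i j : ι} (hij : i ≠ j) (A : Matrix (α i) (α i) ℝ)
    (B : Matrix (α j) (α j) ℝ) (c d : ∀ u, α u) [Decidable (∀ u, u ≠ i → u ≠ j → c u = d u)] :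
    (localOp i A * localOp j B) c d =
      if ∀ u, u ≠ i → u ≠ j → c u = d u then A (c i) (d i) * B (c j) (d j) else 0 := by
  classical
  simp only [localOp_eq_tensorMatrix, tensorMatrix_mul]
  rw [tensorMatrix, ← Finset.mul_prod_erase _ _ (Finset.mem_univ i),
    ← Finset.mul_prod_erase _ _ (Finset.mem_erase.2 ⟨hij.symm, Finset.mem_univ j⟩)]
  have h : ∏ u ∈ (Finset.univ.erase i).erase j,
      (Function.update (fun u => (1 : Matrix (α u) (α u) ℝ)) i A u *
        Function.update (fun u => (1 : Matrix (α u) (α u) ℝ)) j B u) (c u) (d u)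
      = ∏ u ∈ (Finset.univ.erase i).erase j, if c u = d u then 1 else 0 := by
    refine Finset.prod_congr rfl fun u hu => ?_
    simp only [Finset.mem_erase] at hu
    rw [Function.update_of_ne hu.1, Function.update_of_ne hu.2.1, mul_one, one_apply]
  rw [h, Finset.prod_ite_zero]
  have h' : (∀ u ∈ (Finset.univ.erase i).erase j, c u = d u) ↔
      ∀ u, u ≠ i → u ≠ j → c u = d u := by
    simp only [Finset.mem_erase, Finset.mem_univ, and_true]
    exact ⟨fun h u h1 h2 => h u ⟨h2, h1⟩, fun h u hu => h u hu.2 hu.1⟩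
  simp only [h', Finset.prod_const_one]
  rw [Function.update_self, Function.update_of_ne hij, Function.update_of_ne hij.symm,
    Function.update_self]
  simp

theorem localOp_mulVec [∀ i, Fintype (α i)] (i : ι) (A : Matrix (α i) (α i) ℝ)
    (φ : (∀ u, α u) → ℝ) (c : ∀ u, α u) :
    (localOp i A *ᵥ φ) c = ∑ b, A (c i) b * φ (Function.update c i b) := by
  classical
  simp only [mulVec, dotProduct]
  symm
  refine Finset.sum_of_injOn (fun b => Function.update c i b) ?_ (by simp) ?_ ?_
  · exact fun a _ b _ h => Function.update_injective c i h
  · intro d _ hd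
    rw [localOp, if_neg, zero_mul]
    intro h
    refine hd ⟨d i, by simp, ?_⟩
    funext u
    obtain rfl | hu := eq_or_ne u i
    · simp
    · simp [hu, h u hu]
  · intro b _
    rw [localOp, if_pos]
    · simp
    · intro u hu
      simp [hu]

end Tensor

/-! ### The low-energy space of one clique -/

section Clique

variable {m : ℕ}

/-- The configurations of a clique with at most one occupied vertex: the empty one and the
singletons. -/
def lowConfig : Option (Fin m) → Fin m → Bool
  | none => fun _ => false
  | some a => fun b => decide (b = a)

@[simp] theorem lowConfig_none (b : Fin m) : lowConfig none b = false := rfl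

@[simp] theorem lowConfig_some (a b : Fin m) : lowConfig (some a) b = decide (b = a) := rfl

theorem lowConfig_eq_true {o : Option (Fin m)} {a : Fin m} :
    lowConfig o a = true ↔ o = some a := by
  cases o <;> simp [eq_comm]

theorem lowConfig_injective : Function.Injective (lowConfig (m := m)) := by
  intro o o' h
  refine Option.ext fun a => ?_
  rw [← lowConfig_eq_true, ← lowConfig_eq_true, h]

theorem exists_lowConfig_iff (c : Fin m → Bool) :
    (∃ o, c = lowConfig o) ↔ ∀ a b, a ≠ b → ¬(c a = true ∧ c b = true) := by
  constructor
  · rintro ⟨o, rfl⟩ a b hab ⟨h1, h2⟩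
    rw [lowConfig_eq_true] at h1 h2
    exact hab (Option.some_injective _ (h1.symm.trans h2))
  · intro h
    by_cases hc : ∃ a, c a = true
    · obtain ⟨a, ha⟩ := hc
      refine ⟨some a, funext fun b => ?_⟩
      by_cases hb : b = a
      · simp [hb, ha]
      · simpa [hb] using fun h' => h b a hb ⟨h', ha⟩
    · push Not at hc
      exact ⟨none, funext fun b => by simpa using hc b⟩

/-- The inclusion of the low-energy space of a clique. -/
def lowIncl (m : ℕ) : Matrix (Fin m → Bool) (Option (Fin m)) ℝ :=
  (1 : Matrix (Fin m → Bool) (Fin m → Bool) ℝ).submatrix id lowConfig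

/-- The projector onto the low-energy space of a clique. -/
def lowCliqueProjector (m : ℕ) : Matrix (Fin m → Bool) (Fin m → Bool) ℝ :=
  diagonal fun c => if ∀ a b, a ≠ b → ¬(c a = true ∧ c b = true) then 1 else 0

theorem lowIncl_conj (A : Matrix (Fin m → Bool) (Fin m → Bool) ℝ) :
    (lowIncl m)ᵀ * A * lowIncl m = A.submatrix lowConfig lowConfig := by
  ext o o'
  simp [lowIncl, mul_apply, one_apply]

theorem lowIncl_mul_transpose : lowIncl m * (lowIncl m)ᵀ = lowCliqueProjector m := by
  ext c d
  simp only [lowIncl, lowCliqueProjector, mul_apply, submatrix_apply, transpose_apply, one_apply,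
    diagonal_apply, id, ← exists_lowConfig_iff]
  by_cases hc : ∃ o, c = lowConfig o
  · obtain ⟨o, rfl⟩ := hc
    simp only [lowConfig_injective.eq_iff, ite_mul, one_mul, zero_mul, Finset.sum_ite_eq,
      Finset.mem_univ, if_true, eq_comm (a := d), exists_eq']
  · have h : ∀ o, c ≠ lowConfig o := fun o ho => hc ⟨o, ho⟩
    simp [h]

/-- The basis transformation of a clique within its low-energy space. -/
def lowU (F : SpinZeroFrame m) : Matrix (Option (Fin m)) (CliqueIndex m) ℝ :=
  fun o p =>
    match o, p with
    | none, Sum.inl false => 1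
    | none, _ => 0
    | some _, Sum.inl true => 1 / √(m : ℝ)
    | some _, Sum.inl false => 0
    | some a, Sum.inr k => F.amp k a

theorem singletonState_eq (f : Fin m → ℝ) (c : Fin m → Bool) :
    singletonState f c = ∑ a, if c = lowConfig (some a) then f a else 0 := by
  unfold singletonState
  exact Finset.sum_congr rfl fun a _ => if_congr Iff.rfl rfl rfl

theorem cliqueU_eq (F : SpinZeroFrame m) : cliqueU F = lowIncl m * lowU F := by
  ext c p
  simp only [lowIncl, mul_apply, submatrix_apply, one_apply, Fintype.sum_option, id]
  rcases p with (_ | _) | k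
  · simp only [cliqueU, lowU, mul_one, mul_zero, Finset.sum_const_zero, add_zero]
    exact if_congr Iff.rfl rfl rfl
  all_goals simp [cliqueU, lowU, singletonState_eq]

theorem lowU_transpose_mul (hm : 1 ≤ m) (F : SpinZeroFrame m) : (lowU F)ᵀ * lowU F = 1 := by
  have h0 : (0 : ℝ) < m := by exact_mod_cast hm
  have h1 : √(m : ℝ) * √(m : ℝ) = m := Real.mul_self_sqrt h0.le
  ext p q
  rcases p with (_ | _) | k <;> rcases q with (_ | _) | l <;>
    simp [mul_apply, lowU, Fintype.sum_option, one_apply, ← Finset.sum_mul, ← Finset.mul_sum,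
      F.sum_zero, F.orthonormal]
  field_simp
  rw [sq, h1]

theorem lowU_mul_transpose (hm : 1 ≤ m) (F : SpinZeroFrame m) : lowU F * (lowU F)ᵀ = 1 := by
  -- the clique has `m + 1` low-energy configurations and `2 + (m - 1)` basis states
  have e : Fintype.card (Option (Fin m)) = Fintype.card (CliqueIndex m) := by
    simp; omega
  exact (mul_eq_one_comm_of_card_eq (R := ℝ) _ _ e.symm).1 (lowU_transpose_mul hm F)

theorem cliqueU_transpose_mul (hm : 1 ≤ m) (F : SpinZeroFrame m) :
    (cliqueU F)ᵀ * cliqueU F = 1 := by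
  have h : (lowIncl m)ᵀ * lowIncl m = 1 := by
    have := lowIncl_conj (m := m) 1
    rwa [Matrix.mul_one, submatrix_one _ lowConfig_injective] at this
  rw [cliqueU_eq, transpose_mul, Matrix.mul_assoc, ← Matrix.mul_assoc _ (lowIncl m), h,
    Matrix.one_mul, lowU_transpose_mul hm]

theorem cliqueU_mul_transpose (hm : 1 ≤ m) (F : SpinZeroFrame m) :
    cliqueU F * (cliqueU F)ᵀ = lowCliqueProjector m := by
  rw [cliqueU_eq, transpose_mul, Matrix.mul_assoc, ← Matrix.mul_assoc (lowU F),
    lowU_mul_transpose hm, Matrix.one_mul, lowIncl_mul_transpose]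

theorem cliqueU_conj (F : SpinZeroFrame m) (A : Matrix (Fin m → Bool) (Fin m → Bool) ℝ) :
    (cliqueU F)ᵀ * A * cliqueU F = (lowU F)ᵀ * A.submatrix lowConfig lowConfig * lowU F := by
  rw [cliqueU_eq, transpose_mul, ← lowIncl_conj]
  simp only [Matrix.mul_assoc]

/-! ### The operators of one clique in the angular-momentum basis -/

theorem shiftedZ_eq : shiftedZ = diagonal fun b : Bool => if b then (1 : ℝ) else 0 := by
  ext a b
  cases a <;> cases b <;> simp [shiftedZ, pauliZ]
  norm_num

theorem spinX_apply (a b : Bool) : spinX a b = if a = b then 0 else 1 / 2 := by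
  simp [spinX, pauliX]

/-- The sum of the operators `A_u A_v` over the edges `uv` of a clique
(the double sum meets every edge twice). -/
def cliquePairSum (m : ℕ) (A : Matrix Bool Bool ℝ) : Matrix (Fin m → Bool) (Fin m → Bool) ℝ :=
  (1 / 2 : ℝ) • ∑ a, ∑ b, if a ≠ b then
    localOp (α := fun _ : Fin m => Bool) a A * localOp (α := fun _ : Fin m => Bool) b A else 0

/-- Between low-energy configurations a single spin flip connects the empty one with a singleton. -/
theorem low_spinX (o o' : Option (Fin m)) :
    (∑ a, localOp (α := fun _ : Fin m => Bool) a spinX) (lowConfig o) (lowConfig o') =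
      if o = none ↔ o' = none then 0 else 1 / 2 := by
  rw [Matrix.sum_apply]
  have key : ∀ a : Fin m, localOp (α := fun _ : Fin m => Bool) a spinX (lowConfig o) (lowConfig o')
      = if (o = none ∧ o' = some a) ∨ (o = some a ∧ o' = none) then 1 / 2 else 0 := by
    intro a
    rw [localOp, spinX_apply]
    by_cases h : ∀ u, u ≠ a → lowConfig o u = lowConfig o' u
    · rw [if_pos h]
      rcases o with _ | b <;> rcases o' with _ | b' <;> simp at h ⊢
      · grind
      · grind
      · have h1 := h b
        have h2 := h b'
        grind
    · rw [if_neg h, if_neg]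
      rcases o with _ | b <;> rcases o' with _ | b' <;> simp at h ⊢ <;> grind
  simp only [key]
  rcases o with _ | b <;> rcases o' with _ | b' <;> simp

theorem low_pair_spinX {a b : Fin m} (hab : a ≠ b) (o o' : Option (Fin m)) :
    (localOp (α := fun _ : Fin m => Bool) a spinX * localOp (α := fun _ : Fin m => Bool) b spinX)
      (lowConfig o) (lowConfig o') =
      (if o = some a ∧ o' = some b then 1 / 4 else 0) +
        if o = some b ∧ o' = some a then 1 / 4 else 0 := by
  classical
  rw [localOp_mul_of_ne hab, spinX_apply, spinX_apply]
  by_cases h : ∀ u, u ≠ a → u ≠ b → lowConfig o u = lowConfig o' u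
  · rw [if_pos h]
    rcases o with _ | c <;> rcases o' with _ | c' <;> simp at h ⊢
    · grind
    · grind
    · grind
  · rw [if_neg h, if_neg, if_neg, add_zero]
    · rcases o with _ | c <;> rcases o' with _ | c' <;> simp at h ⊢; grind
    · rcases o with _ | c <;> rcases o' with _ | c' <;> simp at h ⊢; grind

/-- Between low-energy configurations a double spin flip moves the occupied vertex; a pair created
from the empty configuration leaves the low-energy space. -/
theorem low_pairSum_spinX (o o' : Option (Fin m)) :
    cliquePairSum m spinX (lowConfig o) (lowConfig o') =
      if o = none ∨ o' = none ∨ o = o' then 0 else 1 / 4 := by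
  have key : ∀ a b : Fin m, (if a ≠ b then localOp (α := fun _ : Fin m => Bool) a spinX *
      localOp (α := fun _ : Fin m => Bool) b spinX else 0) (lowConfig o) (lowConfig o') =
      if a ≠ b then (if o = some a ∧ o' = some b then 1 / 4 else 0) +
        (if o = some b ∧ o' = some a then 1 / 4 else 0) else 0 := by
    intro a b
    by_cases h : a = b
    · simp [h]
    · rw [if_pos h, if_pos h, low_pair_spinX h]
  simp only [cliquePairSum, Matrix.smul_apply, Matrix.sum_apply, key]
  rcases o with _ | c <;> rcases o' with _ | c'
  · simp
  · simp
  · simp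
  · have key' : ∀ a b : Fin m, (if a ≠ b then
        (if some c = some a ∧ some c' = some b then (1 / 4 : ℝ) else 0) +
          (if some c = some b ∧ some c' = some a then 1 / 4 else 0) else 0) =
        if c = c' then 0 else (if c = a then if c' = b then 1 / 4 else 0 else 0) +
          (if c' = a then if c = b then 1 / 4 else 0 else 0) := by
      intro a b
      grind
    simp only [key']
    by_cases h : c = c'
    · simp [h]
    · simp [h, Finset.sum_add_distrib]
      norm_num

theorem low_shiftedZ (f : Fin m → ℝ) (o o' : Option (Fin m)) :
    (∑ a, f a • localOp (α := fun _ : Fin m => Bool) a shiftedZ) (lowConfig o) (lowConfig o') =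
      if o = o' then o.elim 0 f else 0 := by
  simp only [shiftedZ_eq, localOp_diagonal, Matrix.sum_apply, Matrix.smul_apply, diagonal_apply,
    lowConfig_injective.eq_iff, lowConfig_eq_true]
  split_ifs with h
  · cases o <;> simp
  · simp

theorem low_pairSum_shiftedZ (o o' : Option (Fin m)) :
    cliquePairSum m shiftedZ (lowConfig o) (lowConfig o') = 0 := by
  have key : ∀ a b : Fin m, (if a ≠ b then localOp (α := fun _ : Fin m => Bool) a shiftedZ *
      localOp (α := fun _ : Fin m => Bool) b shiftedZ else 0) (lowConfig o) (lowConfig o') = 0 := by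
    intro a b
    split_ifs with h
    · rw [shiftedZ_eq, localOp_diagonal, localOp_diagonal, diagonal_mul_diagonal, diagonal_apply]
      simp only [lowConfig_eq_true]
      grind
    · rfl
  simp only [cliquePairSum, Matrix.smul_apply, Matrix.sum_apply, key, Finset.sum_const_zero,
    smul_zero]

theorem cliqueU_conj_apply (F : SpinZeroFrame m) (A : Matrix (Fin m → Bool) (Fin m → Bool) ℝ)
    (p q : CliqueIndex m) : ((cliqueU F)ᵀ * A * cliqueU F) p q =
      ∑ o', (∑ o, lowU F o p * A (lowConfig o) (lowConfig o')) * lowU F o' q := by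
  rw [cliqueU_conj]
  simp only [mul_apply, transpose_apply, submatrix_apply]

theorem cliqueU_conj_spinX (hm : 1 ≤ m) (F : SpinZeroFrame m) :
    (cliqueU F)ᵀ * (∑ a, localOp (α := fun _ : Fin m => Bool) a spinX) * cliqueU F =
      fromBlocks (√(m : ℝ) • spinX) 0 0 0 := by
  have h0 : (0 : ℝ) < m := by exact_mod_cast hm
  have h1 : √(m : ℝ) * √(m : ℝ) = m := Real.mul_self_sqrt h0.le
  ext p q
  rw [cliqueU_conj_apply]
  simp only [low_spinX]
  rcases p with (_ | _) | k <;> rcases q with (_ | _) | l <;>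
    simp [lowU, Fintype.sum_option, ← Finset.sum_mul, ← Finset.mul_sum, F.sum_zero, spinX_apply]
  all_goals field_simp; rw [sq, h1]

theorem cliqueU_conj_pairSum_spinX_apply (F : SpinZeroFrame m) (p q : CliqueIndex m) :
    ((cliqueU F)ᵀ * cliquePairSum m spinX * cliqueU F) p q =
      1 / 4 * ((∑ a, lowU F (some a) p) * ∑ a, lowU F (some a) q) -
        1 / 4 * ∑ a, lowU F (some a) p * lowU F (some a) q := by
  have h : ∀ (f : Fin m → ℝ) (b : Fin m),
      ∑ a, f a * (if a = b then 0 else 1 / 4) = 1 / 4 * ∑ a, f a - 1 / 4 * f b := by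
    intro f b
    rw [← Finset.add_sum_erase _ f (Finset.mem_univ b),
      ← Finset.add_sum_erase _ _ (Finset.mem_univ b),
      Finset.sum_congr rfl fun a ha => by rw [if_neg (Finset.ne_of_mem_erase ha)],
      ← Finset.sum_mul, if_pos rfl]
    ring
  rw [cliqueU_conj_apply]
  simp only [low_pairSum_spinX, Fintype.sum_option, true_or, if_true, mul_zero,
    Finset.sum_const_zero, zero_mul, zero_add, reduceCtorEq, false_or, Option.some.injEq,
    h, sub_mul, Finset.sum_sub_distrib]
  rw [← Finset.mul_sum]
  simp only [mul_assoc, ← Finset.mul_sum]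

theorem cliqueU_conj_pairSum_spinX (hm : 1 ≤ m) (F : SpinZeroFrame m) :
    (cliqueU F)ᵀ * cliquePairSum m spinX * cliqueU F =
      fromBlocks ((((m : ℝ) - 1) / 4) • shiftedZ) 0 0 (-(1 / 4 : ℝ) • 1) := by
  have h0 : (0 : ℝ) < m := by exact_mod_cast hm
  have h1 : √(m : ℝ) * √(m : ℝ) = m := Real.mul_self_sqrt h0.le
  ext p q
  rw [cliqueU_conj_pairSum_spinX_apply]
  rcases p with (_ | _) | k <;> rcases q with (_ | _) | l <;>
    simp [lowU, shiftedZ_eq, ← Finset.sum_mul, ← Finset.mul_sum, F.sum_zero, F.orthonormal,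
      one_apply]
  field_simp
  rw [sq, h1]

theorem cliqueU_conj_pairSum_shiftedZ (F : SpinZeroFrame m) :
    (cliqueU F)ᵀ * cliquePairSum m shiftedZ * cliqueU F = 0 := by
  ext p q
  rw [cliqueU_conj_apply]
  simp [low_pairSum_shiftedZ]

theorem cliqueU_conj_shiftedZ_apply (F : SpinZeroFrame m) (f : Fin m → ℝ) (p q : CliqueIndex m) :
    ((cliqueU F)ᵀ * (∑ a, f a • localOp (α := fun _ : Fin m => Bool) a shiftedZ) * cliqueU F) p q =
      ∑ a, f a * (lowU F (some a) p * lowU F (some a) q) := by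
  rw [cliqueU_conj_apply]
  simp only [low_shiftedZ, Fintype.sum_option]
  simp [mul_ite]
  exact Finset.sum_congr rfl fun a _ => by ring

/-- The spin-zero states of an adapted frame other than the first one vanish at the shared
vertex. -/
theorem SpinZeroFrame.Adapted.amp_eq_zero {F : SpinZeroFrame m} {s : Fin m} (hF : F.Adapted s)
    {k : Fin (m - 1)} (hk : (k : ℕ) ≠ 0) : F.amp k s = 0 := by
  have h : 0 < m - 1 := by omega
  have hm : (1 : ℝ) < m := by
    have : 1 < m := by omega
    exact_mod_cast this
  have hd : 0 < √(((m : ℝ) - 1) / m) + √(1 / (m : ℝ)) * (1 / √((m : ℝ) - 1)) := by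
    have h1 : 0 < √(((m : ℝ) - 1) / m) := Real.sqrt_pos.2 (div_pos (by linarith) (by linarith))
    positivity
  -- the first state is constant off `s`, so its inner product with a zero-sum state sees only `s`
  have hort := F.orthonormal ⟨0, h⟩ k
  rw [if_neg (by rw [Fin.ext_iff]; exact hk.symm)] at hort
  have hsum : ∑ a, F.amp ⟨0, h⟩ a * F.amp k a =
      (√(((m : ℝ) - 1) / m) + √(1 / (m : ℝ)) * (1 / √((m : ℝ) - 1))) * F.amp k s
        - √(1 / (m : ℝ)) * (1 / √((m : ℝ) - 1)) * ∑ a, F.amp k a := by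
    rw [← Finset.add_sum_erase _ _ (Finset.mem_univ s),
      ← Finset.add_sum_erase _ (F.amp k) (Finset.mem_univ s), Finset.sum_congr rfl fun a ha => by
        rw [hF h a, if_neg (Finset.ne_of_mem_erase ha)], ← Finset.mul_sum, hF h s, if_pos rfl]
    ring
  rw [hort, F.sum_zero, mul_zero, sub_zero] at hsum
  exact (mul_eq_zero.1 hsum.symm).resolve_left hd.ne'

theorem cliqueU_conj_sum_shiftedZ (hm : 1 ≤ m) (F : SpinZeroFrame m) :
    (cliqueU F)ᵀ * (∑ a, localOp (α := fun _ : Fin m => Bool) a shiftedZ) * cliqueU F =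
      fromBlocks shiftedZ 0 0 1 := by
  have h0 : (0 : ℝ) < m := by exact_mod_cast hm
  have h1 : √(m : ℝ) * √(m : ℝ) = m := Real.mul_self_sqrt h0.le
  have h := cliqueU_conj_shiftedZ_apply F (fun _ => 1)
  simp only [one_smul, one_mul] at h
  ext p q
  rw [h]
  rcases p with (_ | _) | k <;> rcases q with (_ | _) | l <;>
    simp [lowU, shiftedZ_eq, ← Finset.sum_mul, ← Finset.mul_sum, F.sum_zero, F.orthonormal,
      one_apply]
  field_simp
  rw [sq, h1]

/-- The occupation of all vertices but the shared one. Its matrix elements differ from those of the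
total occupation by the product of two amplitudes at the shared vertex; of the angular-momentum
states only the uniform superposition and the first spin-zero state do not vanish there. -/
theorem cliqueU_conj_shiftedZ_ne (hm : 1 ≤ m) (F : SpinZeroFrame m) (s : Fin m)
    (hF : F.Adapted s) :
    (cliqueU F)ᵀ * (∑ a, (if a ≠ s then (1 : ℝ) else 0) •
        localOp (α := fun _ : Fin m => Bool) a shiftedZ) * cliqueU F =
      fromBlocks ((((m : ℝ) - 1) / m) • shiftedZ) 0 0
          (diagonal fun k : Fin (m - 1) => if (k : ℕ) = 0 then 1 / (m : ℝ) else 1) +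
        (√((m : ℝ) - 1) / m) • cqOp m := by
  have h0 : (0 : ℝ) < m := by exact_mod_cast hm
  have h1 : √(m : ℝ) * √(m : ℝ) = m := Real.mul_self_sqrt h0.le
  have hsub : (0 : ℝ) ≤ (m : ℝ) - 1 := by
    have : (1 : ℝ) ≤ m := by exact_mod_cast hm
    linarith
  have e1 : 1 / √(m : ℝ) * (1 / √(m : ℝ)) = 1 / m := by
    rw [div_mul_div_comm, h1, one_mul]
  have e2 : √((m : ℝ) - 1) / √(m : ℝ) * (1 / √(m : ℝ)) = √((m : ℝ) - 1) / m := by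
    rw [div_mul_div_comm, h1, mul_one]
  have e3 : √((m : ℝ) - 1) / √(m : ℝ) * (√((m : ℝ) - 1) / √(m : ℝ)) = ((m : ℝ) - 1) / m := by
    rw [div_mul_div_comm, h1, Real.mul_self_sqrt hsub]
  have hamp : ∀ k : Fin (m - 1), F.amp k s = if (k : ℕ) = 0 then √((m : ℝ) - 1) / √m else 0 := by
    intro k
    split_ifs with hk
    · have h : 0 < m - 1 := by omega
      have : k = ⟨0, h⟩ := Fin.ext hk
      rw [this, hF h s, if_pos rfl, Real.sqrt_div hsub]
    · exact hF.amp_eq_zero hk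
  have htot : ∀ p q, ∑ a, lowU F (some a) p * lowU F (some a) q =
      fromBlocks shiftedZ 0 0 (1 : Matrix (Fin (m - 1)) (Fin (m - 1)) ℝ) p q := by
    intro p q
    rw [← cliqueU_conj_sum_shiftedZ hm F]
    simpa using (cliqueU_conj_shiftedZ_apply F (fun _ => 1) p q).symm
  ext p q
  have hsplit : ∑ a, (if a ≠ s then (1 : ℝ) else 0) * (lowU F (some a) p * lowU F (some a) q) =
      fromBlocks shiftedZ 0 0 (1 : Matrix (Fin (m - 1)) (Fin (m - 1)) ℝ) p q
        - lowU F (some s) p * lowU F (some s) q := by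
    rw [← htot, ← Finset.add_sum_erase _ _ (Finset.mem_univ s),
      ← Finset.add_sum_erase _ (fun a => lowU F (some a) p * lowU F (some a) q)
        (Finset.mem_univ s),
      Finset.sum_congr rfl fun a ha => by rw [if_pos (Finset.ne_of_mem_erase ha), one_mul]]
    simp
  rw [cliqueU_conj_shiftedZ_apply, hsplit]
  rcases p with (_ | _) | k <;> rcases q with (_ | _) | l <;>
    simp only [lowU, shiftedZ_eq, fromBlocks_apply₁₁, fromBlocks_apply₁₂, fromBlocks_apply₂₁,
      fromBlocks_apply₂₂, Matrix.add_apply, Matrix.smul_apply, cqOp, diagonal_apply, hamp,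
      one_apply, Matrix.zero_apply, smul_eq_mul]
  · simp
  · simp
  · simp
  · simp
  · rw [e1]
    field_simp
    simp
  · split_ifs
    · rw [mul_comm, e2]
      ring
    · simp
  · simp
  · split_ifs
    · rw [e2]
      ring
    · simp
  · by_cases hk : (k : ℕ) = 0 <;> by_cases hl : (l : ℕ) = 0
    · obtain rfl : k = l := Fin.ext (hk.trans hl.symm)
      simp only [if_true, hk, e3]
      field_simp
      ring
    · simp [hk, hl, Fin.ext_iff, Ne.symm hl]
    · simp [hk, hl, Fin.ext_iff]
    · simp [hk, hl]

end Clique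

/-! ### The operators of the whole system as tensor products -/

theorem sum_kronecker {κ a b c d : Type*} (t : Finset κ) (A : κ → Matrix a b ℝ)
    (B : Matrix c d ℝ) : (∑ k ∈ t, A k) ⊗ₖ B = ∑ k ∈ t, A k ⊗ₖ B := by
  ext p q
  simp [Matrix.sum_apply, Finset.sum_mul]

theorem neg_kronecker {a b c d : Type*} (A : Matrix a b ℝ) (B : Matrix c d ℝ) :
    (-A) ⊗ₖ B = -(A ⊗ₖ B) := by
  ext
  simp

theorem kronecker_neg {a b c d : Type*} (A : Matrix a b ℝ) (B : Matrix c d ℝ) :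
    A ⊗ₖ (-B) = -(A ⊗ₖ B) := by
  ext
  simp

theorem ite_congr_prop {P Q : Prop} {_ : Decidable P} {_ : Decidable Q} (h : P ↔ Q) (a b : ℝ) :
    (if P then a else b) = if Q then a else b := if_congr h rfl rfl

section System

variable {L R : Type*} {n : L → ℕ}

theorem driverGraph_adj_inl {v w : Σ i : L, Fin (n i)} :
    (driverGraph n R).Adj (Sum.inl v) (Sum.inl w) ↔ v ≠ w ∧ v.1 = w.1 := by
  obtain ⟨i, a⟩ := v
  obtain ⟨i', b⟩ := w
  simp only [driverGraph, SimpleGraph.fromRel_adj, ne_eq, Sum.inl.injEq, and_congr_right_iff]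
  intro _
  constructor
  · rintro (⟨k, c, d, h1, h2⟩ | ⟨k, c, d, h1, h2⟩)
    · exact (congrArg Sigma.fst h1).trans (congrArg Sigma.fst h2).symm
    · exact (congrArg Sigma.fst h2).trans (congrArg Sigma.fst h1).symm
  · intro h
    obtain rfl : i = i' := h
    exact Or.inl ⟨i, a, b, rfl, rfl⟩

theorem driverGraph_not_adj_inr (u : Vertex n R) (j : R) :
    ¬(driverGraph n R).Adj u (Sum.inr j) := by
  simp [driverGraph]

theorem driverGraph_not_inr_adj (u : Vertex n R) (j : R) :
    ¬(driverGraph n R).Adj (Sum.inr j) u := fun h => driverGraph_not_adj_inr u j h.symm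

theorem crossGraph_adj_inl_inr (K : StructureKind n) {v : Σ i : L, Fin (n i)} {j : R} :
    (problemGraph R K \ driverGraph n R).Adj (Sum.inl v) (Sum.inr j) ↔ K.Coupled v.1 v.2 := by
  simp only [SimpleGraph.sdiff_adj, driverGraph_not_adj_inr, not_false_eq_true, and_true,
    problemGraph, SimpleGraph.sup_adj, false_or, SimpleGraph.fromRel_adj]
  constructor
  · rintro ⟨_, ⟨i, a, k, h, h1, _⟩ | ⟨i, a, k, h, h1, _⟩⟩
    · obtain rfl := Sum.inl_injective h1
      exact h
    · cases h1
  · exact fun h => ⟨by simp, Or.inl ⟨v.1, v.2, j, h, rfl, rfl⟩⟩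

theorem crossGraph_not_adj_inl_inl (K : StructureKind n) (v w : Σ i : L, Fin (n i)) :
    ¬(problemGraph R K \ driverGraph n R).Adj (Sum.inl v) (Sum.inl w) := by
  simp [problemGraph]

theorem crossGraph_not_adj_inr_inr (K : StructureKind n) (j k : R) :
    ¬(problemGraph R K \ driverGraph n R).Adj (Sum.inr j) (Sum.inr k) := by
  simp [problemGraph, driverGraph_not_adj_inr]

/-- The weight `1` on the clique vertices that are adjacent to `R` and `0` on the others. -/
def StructureKind.coupling (K : StructureKind n) (i : L) (a : Fin (n i)) : ℝ :=
  match K with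
  | .dis => 1
  | .share s => if a ≠ s i then 1 else 0

theorem StructureKind.coupling_eq (K : StructureKind n) (i : L) (a : Fin (n i))
    [Decidable (K.Coupled i a)] : K.coupling i a = if K.Coupled i a then 1 else 0 := by
  cases K with
  | dis => simp [coupling, Coupled]
  | share s => exact ite_congr_prop Iff.rfl _ _

/-- A configuration of all vertices, split into those of the cliques and that of `R`. -/
def configEquiv (n : L → ℕ) (R : Type*) :
    (Vertex n R → Bool) ≃ (∀ i, Fin (n i) → Bool) × (R → Bool) where
  toFun c := (fun i a => c (Sum.inl ⟨i, a⟩), fun j => c (Sum.inr j))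
  invFun z := Sum.elim (fun v => z.1 v.1 v.2) z.2
  left_inv c := by
    funext v
    rcases v with ⟨i, a⟩ | j <;> rfl
  right_inv z := rfl

theorem configEquiv_apply (c : Vertex n R → Bool) :
    configEquiv n R c = (fun i a => c (Sum.inl ⟨i, a⟩), fun j => c (Sum.inr j)) := rfl

variable [Fintype L] [Fintype R]

theorem edgeSum_crossGraph (K : StructureKind n) {M : Type*} [AddCommMonoid M] [Module ℝ M]
    (f : Vertex n R → Vertex n R → M) (hf : ∀ u v, f u v = f v u) :
    edgeSum (problemGraph R K \ driverGraph n R) f =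
      ∑ i, ∑ j, ∑ a, K.coupling i a • f (Sum.inl ⟨i, a⟩) (Sum.inr j) := by
  classical
  have h : ∀ (v : Σ i : L, Fin (n i)) (j : R),
      (problemGraph R K \ driverGraph n R).Adj (Sum.inr j) (Sum.inl v) ↔ K.Coupled v.1 v.2 :=
    fun v j => (SimpleGraph.adj_comm _ _ _).trans (crossGraph_adj_inl_inr K)
  have hc : ∀ (i : L) (a : Fin (n i)) (y : M),
      (if K.Coupled i a then y else 0) = K.coupling i a • y := by
    intro i a y
    rw [K.coupling_eq]
    split_ifs <;> simp
  have hs : ∀ y : M, (1 / 2 : ℝ) • (y + y) = y := by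
    intro y
    rw [← two_smul ℝ y, smul_smul]
    norm_num
  rw [edgeSum]
  simp only [Fintype.sum_sum_type, crossGraph_not_adj_inl_inl, crossGraph_not_adj_inr_inr, if_false,
    Finset.sum_const_zero, add_zero, zero_add, crossGraph_adj_inl_inr, h]
  rw [Finset.sum_comm (s := (Finset.univ : Finset R))]
  simp only [hf (Sum.inr _) (Sum.inl _), hs, Fintype.sum_sigma, hc]
  exact Finset.sum_congr rfl fun i _ => Finset.sum_comm

theorem angU_eq [DecidableEq R] (F : ∀ i, SpinZeroFrame (n i)) :
    angU R F = (tensorMatrix (fun i => cliqueU (F i)) ⊗ₖ (1 : Matrix (R → Bool) (R → Bool) ℝ)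
      ).submatrix (configEquiv n R) id := by
  ext c p
  simp only [angU, submatrix_apply, kroneckerMap_apply, tensorMatrix, one_apply, id,
    configEquiv_apply]

variable [DecidableEq L]

theorem edgeSum_driverGraph {M : Type*} [AddCommMonoid M] [Module ℝ M]
    (f : Vertex n R → Vertex n R → M) :
    edgeSum (driverGraph n R) f =
      ∑ i, (1 / 2 : ℝ) • ∑ a, ∑ b, if a ≠ b then f (Sum.inl ⟨i, a⟩) (Sum.inl ⟨i, b⟩) else 0 := by
  rw [edgeSum, ← Finset.smul_sum]
  congr 1
  simp only [Fintype.sum_sum_type, driverGraph_not_adj_inr, driverGraph_not_inr_adj, if_false,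
    Finset.sum_const_zero, add_zero, driverGraph_adj_inl, Fintype.sum_sigma]
  refine Finset.sum_congr rfl fun i _ => Finset.sum_congr rfl fun a _ => ?_
  rw [Fintype.sum_eq_single i]
  · refine Finset.sum_congr rfl fun b _ => if_congr ?_ rfl rfl
    simp
  · intro i' hi
    exact Finset.sum_eq_zero fun b _ => if_neg fun h => hi h.2.symm

variable [DecidableEq R]

/-- An operator on the tensor product of the clique spaces and the spaces of `R`, as an operator on
the configurations of all vertices. -/
def assemble (n : L → ℕ) (R : Type*) [Fintype R] [DecidableEq R] :
    Matrix ((∀ i, Fin (n i) → Bool) × (R → Bool)) ((∀ i, Fin (n i) → Bool) × (R → Bool)) ℝ ≃ₐ[ℝ]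
      Matrix (Vertex n R → Bool) (Vertex n R → Bool) ℝ :=
  reindexAlgEquiv ℝ ℝ (configEquiv n R).symm

theorem assemble_apply (M : Matrix ((∀ i, Fin (n i) → Bool) × (R → Bool))
    ((∀ i, Fin (n i) → Bool) × (R → Bool)) ℝ) (c d : Vertex n R → Bool) :
    assemble n R M c d = M (configEquiv n R c) (configEquiv n R d) := rfl

/-- The operator `A` on the clique `i`. -/
abbrev cliqueOp (i : L) (A : Matrix (Fin (n i) → Bool) (Fin (n i) → Bool) ℝ) :
    Matrix (∀ i, Fin (n i) → Bool) (∀ i, Fin (n i) → Bool) ℝ :=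
  localOp (α := fun i : L => Fin (n i) → Bool) i A

/-- The operator `A` on the vertex `j ∈ R`. -/
abbrev siteOp (j : R) (A : Matrix Bool Bool ℝ) : Matrix (R → Bool) (R → Bool) ℝ :=
  localOp (α := fun _ : R => Bool) j A

theorem localOp_inl (i : L) (a : Fin (n i)) (A : Matrix Bool Bool ℝ) :
    localOp (α := fun _ : Vertex n R => Bool) (Sum.inl ⟨i, a⟩) A =
      assemble n R (cliqueOp i (localOp (α := fun _ : Fin (n i) => Bool) a A) ⊗ₖ 1) := by
  ext c d
  simp only [assemble_apply, kroneckerMap_apply, localOp, one_apply, configEquiv_apply,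
    ← ite_and, mul_ite, mul_one, mul_zero]
  refine ite_congr_prop ?_ _ _
  constructor
  · intro h
    refine ⟨funext fun j => h _ (by simp), fun i' hi => funext fun b => h _ ?_, fun b hb => h _ ?_⟩
    · rw [ne_eq, Sum.inl.injEq]
      exact fun h' => hi (congrArg Sigma.fst h')
    · simpa using hb
  · rintro ⟨h1, h2, h3⟩ (⟨i', b⟩ | j) hu
    · obtain rfl | hi := eq_or_ne i' i
      · exact h3 b (by simpa using hu)
      · exact congrFun (h2 i' hi) b
    · exact congrFun h1 j

theorem localOp_inr (j : R) (A : Matrix Bool Bool ℝ) :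
    localOp (α := fun _ : Vertex n R => Bool) (Sum.inr j) A =
      assemble n R (1 ⊗ₖ siteOp j A) := by
  ext c d
  simp only [assemble_apply, kroneckerMap_apply, localOp, one_apply, configEquiv_apply,
    ← ite_and, ite_mul, one_mul, zero_mul]
  refine ite_congr_prop ?_ _ _
  constructor
  · intro h
    exact ⟨funext fun i => funext fun a => h _ (by simp), fun k hk => h _ (by simpa using hk)⟩
  · rintro ⟨h1, h2⟩ (⟨i', b⟩ | k) hu
    · exact congrFun (congrFun h1 i') b
    · exact h2 k (by simpa using hu)

theorem edgeSum_driverGraph_localOp (A : Matrix Bool Bool ℝ) :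
    edgeSum (driverGraph n R) (fun u v => localOp u A * localOp v A) =
      ∑ i, assemble n R (cliqueOp i (cliquePairSum (n i) A) ⊗ₖ 1) := by
  rw [edgeSum_driverGraph]
  refine Finset.sum_congr rfl fun i _ => ?_
  have h : ∀ a b : Fin (n i), (if a ≠ b then localOp (α := fun _ : Vertex n R => Bool)
      (Sum.inl ⟨i, a⟩) A * localOp (Sum.inl ⟨i, b⟩) A else 0) =
      assemble n R (cliqueOp i (if a ≠ b then localOp (α := fun _ : Fin (n i) => Bool) a A *
        localOp (α := fun _ : Fin (n i) => Bool) b A else 0) ⊗ₖ 1) := by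
    intro a b
    split_ifs
    · rw [localOp_inl, localOp_inl, ← map_mul, ← mul_kronecker_mul, localOp_mul, Matrix.one_mul]
    · rw [cliqueOp, localOp_zero, zero_kronecker, map_zero]
  simp only [h, cliquePairSum, cliqueOp, localOp_smul, localOp_sum, smul_kronecker, sum_kronecker,
    map_smul, map_sum]

theorem localOp_mul_comm_of_diagonal (f : Bool → ℝ) (u v : Vertex n R) :
    localOp (α := fun _ : Vertex n R => Bool) u (diagonal f) * localOp v (diagonal f) =
      localOp v (diagonal f) * localOp u (diagonal f) := by
  rw [localOp_diagonal, localOp_diagonal, diagonal_mul_diagonal, diagonal_mul_diagonal]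
  simp only [mul_comm]

theorem edgeSum_crossGraph_localOp (K : StructureKind n) :
    edgeSum (problemGraph R K \ driverGraph n R)
        (fun u v => localOp u shiftedZ * localOp v shiftedZ) =
      ∑ i, ∑ j, assemble n R (cliqueOp i (∑ a, K.coupling i a •
        localOp (α := fun _ : Fin (n i) => Bool) a shiftedZ) ⊗ₖ siteOp j shiftedZ) := by
  rw [edgeSum_crossGraph K _ fun u v => by rw [shiftedZ_eq, localOp_mul_comm_of_diagonal]]
  refine Finset.sum_congr rfl fun i _ => Finset.sum_congr rfl fun j _ => ?_
  simp only [localOp_inl, localOp_inr, ← map_mul, ← mul_kronecker_mul, Matrix.one_mul,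
    Matrix.mul_one, cliqueOp, localOp_sum, localOp_smul, sum_kronecker, smul_kronecker, map_sum,
    map_smul]

/-! ### The angular-momentum basis of the whole system -/

theorem angU_conj_assemble (F : ∀ i, SpinZeroFrame (n i))
    (M : Matrix ((∀ i, Fin (n i) → Bool) × (R → Bool))
      ((∀ i, Fin (n i) → Bool) × (R → Bool)) ℝ) :
    (angU R F)ᵀ * assemble n R M * angU R F =
      (tensorMatrix (fun i => cliqueU (F i)) ⊗ₖ (1 : Matrix (R → Bool) (R → Bool) ℝ))ᵀ * M *
        (tensorMatrix (fun i => cliqueU (F i)) ⊗ₖ (1 : Matrix (R → Bool) (R → Bool) ℝ)) := by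
  have h : assemble n R M = M.submatrix (configEquiv n R) (configEquiv n R) := rfl
  rw [angU_eq, h, transpose_submatrix, submatrix_mul_equiv, submatrix_mul_equiv, submatrix_id_id]

theorem angU_transpose_mul (hn : ∀ i, 1 ≤ n i) (F : ∀ i, SpinZeroFrame (n i)) :
    (angU R F)ᵀ * angU R F = 1 := by
  have h := angU_conj_assemble (R := R) F 1
  rw [map_one, Matrix.mul_one, Matrix.mul_one] at h
  rw [h, ← kroneckerMap_transpose, ← mul_kronecker_mul, tensorMatrix_transpose, tensorMatrix_mul]
  simp only [cliqueU_transpose_mul (hn _), tensorMatrix_one, transpose_one, Matrix.one_mul,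
    one_kronecker_one]

theorem angU_mul_transpose (hn : ∀ i, 1 ≤ n i) (F : ∀ i, SpinZeroFrame (n i)) :
    angU R F * (angU R F)ᵀ = lowProjector n R := by
  have h : angU R F * (angU R F)ᵀ =
      (tensorMatrix (fun i => cliqueU (F i)) ⊗ₖ (1 : Matrix (R → Bool) (R → Bool) ℝ) *
        (tensorMatrix (fun i => cliqueU (F i)) ⊗ₖ (1 : Matrix (R → Bool) (R → Bool) ℝ))ᵀ).submatrix
          (configEquiv n R) (configEquiv n R) := by
    rw [angU_eq, transpose_submatrix, ← submatrix_mul _ _ _ _ _ Function.bijective_id]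
  rw [h, ← kroneckerMap_transpose, ← mul_kronecker_mul, tensorMatrix_transpose, tensorMatrix_mul]
  simp only [cliqueU_mul_transpose (hn _), transpose_one, Matrix.one_mul]
  classical
  ext c d
  simp only [submatrix_apply, kroneckerMap_apply, tensorMatrix, lowCliqueProjector, diagonal_apply,
    one_apply, lowProjector, configEquiv_apply, ← ite_and, Finset.prod_ite_zero,
    Finset.prod_const_one, mul_ite, mul_one, mul_zero, Finset.mem_univ, true_imp_iff]
  refine ite_congr_prop ?_ _ _
  constructor
  · rintro ⟨h1, h2⟩
    refine ⟨?_, ?_⟩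
    · funext v
      rcases v with ⟨i, a⟩ | j
      · exact congrFun (h2 i).1 a
      · exact congrFun h1 j
    · rintro (⟨i, a⟩ | j) (⟨i', b⟩ | k) hadj
      · obtain ⟨hab, hi⟩ := driverGraph_adj_inl.1 hadj
        obtain rfl : i = i' := hi
        exact (h2 i).2 a b fun h => hab (by rw [h])
      · exact absurd hadj (driverGraph_not_adj_inr _ _)
      · exact absurd hadj (driverGraph_not_inr_adj _ _)
      · exact absurd hadj (driverGraph_not_adj_inr _ _)
  · rintro ⟨rfl, h⟩
    refine ⟨rfl, fun i => ⟨rfl, fun a b hab => h _ _ (driverGraph_adj_inl.2 ⟨?_, rfl⟩)⟩⟩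
    simpa using hab

/-- Conjugation by the basis transformation, as a linear map on operators. -/
def angConj (F : ∀ i, SpinZeroFrame (n i)) :
    Matrix (Vertex n R → Bool) (Vertex n R → Bool) ℝ →ₗ[ℝ] Matrix (AngIndex n R) (AngIndex n R) ℝ
    where
  toFun M := (angU R F)ᵀ * M * angU R F
  map_add' M N := by rw [Matrix.mul_add, Matrix.add_mul]
  map_smul' r M := by rw [Matrix.mul_smul, Matrix.smul_mul, RingHom.id_apply]

theorem angConj_apply (F : ∀ i, SpinZeroFrame (n i))
    (M : Matrix (Vertex n R → Bool) (Vertex n R → Bool) ℝ) :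
    angConj F M = (angU R F)ᵀ * M * angU R F := rfl

/-- The low-energy projector is absorbed by the basis transformation. -/
theorem angH_eq (hn : ∀ i, 1 ≤ n i) (F : ∀ i, SpinZeroFrame (n i)) (K : StructureKind n)
    (wL : L → ℝ) (wR : R → ℝ) (Jclique Jzz x jxx : ℝ) :
    angH F K wL wR Jclique Jzz x jxx = angConj F (systemH K wL wR Jclique Jzz x jxx) := by
  have h1 : lowProjector n R * angU R F = angU R F := by
    rw [← angU_mul_transpose hn F, Matrix.mul_assoc, angU_transpose_mul hn, Matrix.mul_one]
  have h2 : (angU R F)ᵀ * lowProjector n R = (angU R F)ᵀ := by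
    rw [← angU_mul_transpose hn F, ← Matrix.mul_assoc, angU_transpose_mul hn, Matrix.one_mul]
  rw [angConj_apply, angH, effectiveH, ← Matrix.mul_assoc, ← Matrix.mul_assoc, h2,
    Matrix.mul_assoc _ _ (angU R F), h1]

/-- The operator `A`, in the angular-momentum basis, on the clique `i`. -/
abbrev angCliqueOp (i : L) (A : Matrix (CliqueIndex (n i)) (CliqueIndex (n i)) ℝ) :
    Matrix (∀ i, CliqueIndex (n i)) (∀ i, CliqueIndex (n i)) ℝ :=
  localOp (α := fun i : L => CliqueIndex (n i)) i A

theorem angConj_cliqueOp (hn : ∀ i, 1 ≤ n i) (F : ∀ i, SpinZeroFrame (n i)) (i : L)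
    (A : Matrix (Fin (n i) → Bool) (Fin (n i) → Bool) ℝ) (B : Matrix (R → Bool) (R → Bool) ℝ) :
    angConj F (assemble n R (cliqueOp i A ⊗ₖ B)) =
      angCliqueOp i ((cliqueU (F i))ᵀ * A * cliqueU (F i)) ⊗ₖ B := by
  rw [angConj_apply, angU_conj_assemble, ← kroneckerMap_transpose, ← mul_kronecker_mul,
    ← mul_kronecker_mul, tensorMatrix_conj_localOp _ fun i => cliqueU_transpose_mul (hn i) (F i),
    transpose_one, Matrix.one_mul, Matrix.mul_one]

theorem angConj_siteOp (hn : ∀ i, 1 ≤ n i) (F : ∀ i, SpinZeroFrame (n i)) (j : R)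
    (A : Matrix Bool Bool ℝ) :
    angConj F (assemble n R (1 ⊗ₖ siteOp j A)) =
      (1 : Matrix (∀ i, CliqueIndex (n i)) (∀ i, CliqueIndex (n i)) ℝ) ⊗ₖ siteOp j A := by
  rw [angConj_apply, angU_conj_assemble, ← kroneckerMap_transpose, ← mul_kronecker_mul,
    ← mul_kronecker_mul, Matrix.mul_one, tensorMatrix_transpose, tensorMatrix_mul,
    transpose_one, Matrix.one_mul, Matrix.mul_one]
  simp only [cliqueU_transpose_mul (hn _), tensorMatrix_one]

/-- The clique part of a one-vertex sum, in the angular-momentum basis. -/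
theorem angConj_sum_inl (hn : ∀ i, 1 ≤ n i) (F : ∀ i, SpinZeroFrame (n i)) (i : L)
    (A : Matrix Bool Bool ℝ) :
    ∑ a, angConj F (localOp (α := fun _ : Vertex n R => Bool) (Sum.inl ⟨i, a⟩) A) =
      angCliqueOp i ((cliqueU (F i))ᵀ * (∑ a, localOp (α := fun _ : Fin (n i) => Bool) a A) *
          cliqueU (F i))
        ⊗ₖ 1 := by
  simp only [localOp_inl, angConj_cliqueOp hn]
  rw [← sum_kronecker, Matrix.mul_sum, Matrix.sum_mul, angCliqueOp, localOp_sum]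

theorem angConj_transverseH (hn : ∀ i, 1 ≤ n i) (F : ∀ i, SpinZeroFrame (n i)) :
    angConj F (transverseH n R) =
      -(∑ i, angCliqueOp i (fromBlocks (√(n i : ℝ) • spinX) 0 0 0) ⊗ₖ 1
        + ∑ j, (1 : Matrix (∀ i, CliqueIndex (n i)) (∀ i, CliqueIndex (n i)) ℝ)
          ⊗ₖ siteOp j spinX) := by
  rw [transverseH, map_neg, map_sum, Fintype.sum_sum_type, Fintype.sum_sigma]
  simp only [angConj_sum_inl hn, cliqueU_conj_spinX (hn _)]
  simp only [localOp_inr, angConj_siteOp hn]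

theorem angConj_driverH (hn : ∀ i, 1 ≤ n i) (F : ∀ i, SpinZeroFrame (n i)) :
    angConj F (driverH n R) =
      ∑ i, angCliqueOp i (fromBlocks ((((n i : ℝ) - 1) / 4) • shiftedZ) 0 0 (-(1 / 4 : ℝ) • 1))
        ⊗ₖ 1 := by
  rw [driverH, edgeSum_driverGraph_localOp, map_sum]
  simp only [angConj_cliqueOp hn, cliqueU_conj_pairSum_spinX (hn _)]

theorem angConj_problemH (hn : ∀ i, 1 ≤ n i) (F : ∀ i, SpinZeroFrame (n i)) (K : StructureKind n)
    (wL : L → ℝ) (wR : R → ℝ) (Jclique Jzz : ℝ) :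
    angConj F (problemH K wL wR Jclique Jzz) =
      (∑ i, angCliqueOp i ((-wL i) • fromBlocks shiftedZ 0 0 1) ⊗ₖ 1
        + ∑ j, (1 : Matrix (∀ i, CliqueIndex (n i)) (∀ i, CliqueIndex (n i)) ℝ)
          ⊗ₖ siteOp j ((-wR j) • shiftedZ))
      + Jzz • ∑ i, ∑ j, angCliqueOp i ((cliqueU (F i))ᵀ * (∑ a, K.coupling i a •
          localOp (α := fun _ : Fin (n i) => Bool) a shiftedZ) * cliqueU (F i)) ⊗ₖ
            siteOp j shiftedZ := by
  rw [problemH, edgeSum_driverGraph_localOp, edgeSum_crossGraph_localOp]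
  simp only [map_add, map_smul, map_sum, angConj_cliqueOp hn, cliqueU_conj_pairSum_shiftedZ,
    angCliqueOp, localOp_zero, zero_kronecker, Finset.sum_const_zero, smul_zero, add_zero]
  rw [Fintype.sum_sum_type, Fintype.sum_sigma]
  simp only [vertexWeight, ← Finset.smul_sum, angConj_sum_inl hn, cliqueU_conj_sum_shiftedZ (hn _)]
  simp only [localOp_inr, angConj_siteOp hn, localOp_smul, smul_kronecker, kronecker_smul,
    angCliqueOp, siteOp]

end System

/-! ### The block structure -/

section Blocks

variable {L R : Type*} {n : L → ℕ}

/-- The coupling of the spin-zero state `k` of clique `i` to `R`. -/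
def StructureKind.spinZeroCoeff (K : StructureKind n) (i : L) (k : Fin (n i - 1)) : ℝ :=
  match K with
  | .dis => 1
  | .share _ => if (k : ℕ) = 0 then 1 / (n i : ℝ) else 1

/-- The coefficient of `T^cq` in the coupling of clique `i` to `R`. -/
def StructureKind.crossCoeff (K : StructureKind n) (i : L) : ℝ :=
  match K with
  | .dis => 0
  | .share _ => √((n i : ℝ) - 1) / n i

theorem StructureKind.spinZeroCoeff_of_isQ {K : StructureKind n} {k : ∀ i, Fin (n i - 1)}
    (hk : K.IsQ k) (i : L) : K.spinZeroCoeff i (k i) = coeffQ K i := by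
  cases K with
  | dis => rfl
  | share s => exact if_pos (hk i)

/-- The part of the coupling operator of clique `i` to `R` that preserves the sectors. -/
def cliqueCouplingDiag (K : StructureKind n) (i : L) :
    Matrix (CliqueIndex (n i)) (CliqueIndex (n i)) ℝ :=
  fromBlocks (coeffC K i • shiftedZ) 0 0 (diagonal (K.spinZeroCoeff i))

/-- The sector-preserving one-clique Hamiltonian: a two-level system on the effective spin one half
and a constant on the spin-zero states. -/
def cliqueBlockH (n : L → ℕ) (wL : L → ℝ) (x jxx : ℝ) (i : L) :
    Matrix (CliqueIndex (n i)) (CliqueIndex (n i)) ℝ :=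
  fromBlocks (twoLevel (effWeight n wL jxx i) (√(n i : ℝ) * x)) 0 0 ((-(wL i + 1 / 4 * jxx)) • 1)

theorem twoLevel_eq (w x : ℝ) : twoLevel w x = x • -spinX + (-w) • shiftedZ := by
  ext a b
  cases a <;> cases b <;> simp [twoLevel, spinX_apply, shiftedZ_eq]
  all_goals ring

theorem cliqueBlockH_eq (wL : L → ℝ) (x jxx : ℝ) (i : L) :
    cliqueBlockH n wL x jxx i =
      x • -fromBlocks (√(n i : ℝ) • spinX) 0 0 0 +
        jxx • fromBlocks ((((n i : ℝ) - 1) / 4) • shiftedZ) 0 0 (-(1 / 4 : ℝ) • 1) +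
        (-wL i) • fromBlocks shiftedZ 0 0 1 := by
  rw [cliqueBlockH, twoLevel_eq, effWeight]
  simp only [fromBlocks_neg, fromBlocks_smul, fromBlocks_add, neg_zero, smul_zero, add_zero]
  congr 1
  · module
  · module

theorem cliqueU_conj_coupling (hn : ∀ i, 1 ≤ n i) (K : StructureKind n)
    (F : ∀ i, SpinZeroFrame (n i)) (hF : K.Admits F) (i : L) :
    (cliqueU (F i))ᵀ * (∑ a, K.coupling i a •
        localOp (α := fun _ : Fin (n i) => Bool) a shiftedZ) * cliqueU (F i) =
      cliqueCouplingDiag K i + K.crossCoeff i • cqOp (n i) := by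
  cases K with
  | dis =>
    have h := cliqueU_conj_sum_shiftedZ (hn i) (F i)
    simp only [StructureKind.coupling, one_smul, StructureKind.crossCoeff, zero_smul, add_zero,
      cliqueCouplingDiag, coeffC]
    rw [h, ← diagonal_one]
    rfl
  | share s => exact cliqueU_conj_shiftedZ_ne (hn i) (F i) (s i) (hF i)

variable [Fintype L] [DecidableEq L] [Fintype R] [DecidableEq R]

/-- The sector-preserving part of the effective Hamiltonian. -/
def sectorH (K : StructureKind n) (wL : L → ℝ) (wR : R → ℝ) (Jzz x jxx : ℝ) :
    Matrix (AngIndex n R) (AngIndex n R) ℝ :=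
  (∑ i, angCliqueOp i (cliqueBlockH n wL x jxx i) ⊗ₖ 1
    + ∑ j, (1 : Matrix (∀ i, CliqueIndex (n i)) (∀ i, CliqueIndex (n i)) ℝ)
      ⊗ₖ siteOp j (twoLevel (wR j) x))
  + Jzz • ∑ i, ∑ j, angCliqueOp i (cliqueCouplingDiag K i) ⊗ₖ siteOp j shiftedZ

theorem interBlock_eq (K : StructureKind n) (Jzz : ℝ) :
    interBlock R K Jzz =
      Jzz • ∑ i, ∑ j, K.crossCoeff i • (angCliqueOp i (cqOp (n i)) ⊗ₖ siteOp j shiftedZ) := by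
  cases K with
  | dis => simp [interBlock, StructureKind.crossCoeff]
  | share s => rfl

theorem angH_eq_sectorH_add_interBlock (hn : ∀ i, 1 ≤ n i) (K : StructureKind n)
    (F : ∀ i, SpinZeroFrame (n i)) (hF : K.Admits F) (wL : L → ℝ) (wR : R → ℝ)
    (Jclique Jzz x jxx : ℝ) :
    angH F K wL wR Jclique Jzz x jxx = sectorH K wL wR Jzz x jxx + interBlock R K Jzz := by
  rw [angH_eq hn, systemH, map_add, map_add, map_smul, map_smul, angConj_transverseH hn,
    angConj_driverH hn, angConj_problemH hn, sectorH, interBlock_eq]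
  simp only [cliqueU_conj_coupling hn K F hF, cliqueBlockH_eq, twoLevel_eq, angCliqueOp, siteOp,
    localOp_add, localOp_smul, localOp_neg, add_kronecker, kronecker_add, smul_kronecker,
    kronecker_smul, Finset.sum_add_distrib, ← Finset.smul_sum]
  simp only [neg_kronecker, kronecker_neg, Finset.sum_neg_distrib]
  module

/-- A one-clique operator that vanishes between different sectors of the clique is a direct sum over
the sectors. -/
theorem isBlockDiagonal_angCliqueOp {i : L} {A : Matrix (CliqueIndex (n i)) (CliqueIndex (n i)) ℝ}
    (hA : ∀ a b, cliqueSector a ≠ cliqueSector b → A a b = 0)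
    (B : Matrix (R → Bool) (R → Bool) ℝ) : IsBlockDiagonal (angCliqueOp i A ⊗ₖ B) := by
  intro p q h
  rw [kroneckerMap_apply, angCliqueOp, localOp]
  split_ifs with hpq
  · rw [hA _ _ fun hi => h (funext fun u => ?_), zero_mul]
    obtain rfl | hu := eq_or_ne u i
    · exact hi
    · exact congrArg cliqueSector (hpq u hu)
  · rw [zero_mul]

theorem isBlockDiagonal_one_kronecker (B : Matrix (R → Bool) (R → Bool) ℝ) :
    IsBlockDiagonal ((1 : Matrix (∀ i, CliqueIndex (n i)) (∀ i, CliqueIndex (n i)) ℝ) ⊗ₖ B) := by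
  intro p q h
  rw [kroneckerMap_apply, one_apply, if_neg, zero_mul]
  exact fun hpq => h (funext fun u => by rw [sector, sector, hpq])

theorem isBlockDiagonal_sectorH (K : StructureKind n) (wL : L → ℝ) (wR : R → ℝ) (Jzz x jxx : ℝ) :
    IsBlockDiagonal (sectorH K wL wR Jzz x jxx) := by
  have h1 : ∀ i, IsBlockDiagonal (R := R) (angCliqueOp i (cliqueBlockH n wL x jxx i) ⊗ₖ 1) := by
    intro i
    refine isBlockDiagonal_angCliqueOp ?_ _
    rintro (a | k) (b | l) h
    · exact absurd rfl h
    · rfl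
    · rfl
    · have : k ≠ l := fun e => h (by rw [e])
      simp [cliqueBlockH, this]
  have h2 : ∀ i (B : Matrix (R → Bool) (R → Bool) ℝ),
      IsBlockDiagonal (angCliqueOp i (cliqueCouplingDiag K i) ⊗ₖ B) := by
    intro i B
    refine isBlockDiagonal_angCliqueOp ?_ _
    rintro (a | k) (b | l) h
    · exact absurd rfl h
    · rfl
    · rfl
    · have : k ≠ l := fun e => h (by rw [e])
      simp [cliqueCouplingDiag, this]
  intro p q h
  simp only [sectorH, Matrix.add_apply, Matrix.smul_apply, Matrix.sum_apply]
  rw [Finset.sum_eq_zero fun i _ => h1 i p q h,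
    Finset.sum_eq_zero fun j _ => isBlockDiagonal_one_kronecker _ p q h,
    Finset.sum_eq_zero fun i _ => Finset.sum_eq_zero fun j _ => h2 i _ p q h]
  simp

theorem interBlock_apply_of_sector_eq (K : StructureKind n) (Jzz : ℝ) {p q : AngIndex n R}
    (h : sector p = sector q) : interBlock R K Jzz p q = 0 := by
  have key : ∀ i j, (angCliqueOp i (cqOp (n i)) ⊗ₖ siteOp j shiftedZ) p q = 0 := by
    intro i j
    have hi : cliqueSector (p.1 i) = cliqueSector (q.1 i) := congrFun h i
    have h0 : cqOp (n i) (p.1 i) (q.1 i) = 0 := by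
      revert hi
      rcases p.1 i with (_ | _) | k <;> rcases q.1 i with (_ | _) | l <;> simp [cliqueSector, cqOp]
    rw [kroneckerMap_apply, angCliqueOp, localOp, h0, ite_self, zero_mul]
  rw [interBlock_eq]
  simp only [Matrix.smul_apply, Matrix.sum_apply, key, smul_zero, Finset.sum_const_zero]

theorem submatrix_sum {κ a b c d : Type*} (t : Finset κ) (A : κ → Matrix a b ℝ) (f : c → a)
    (g : d → b) : (∑ k ∈ t, A k).submatrix f g = ∑ k ∈ t, (A k).submatrix f g := by
  ext
  simp [Matrix.sum_apply]

theorem angCliqueOp_submatrix_embC (i : L) (A : Matrix (CliqueIndex (n i)) (CliqueIndex (n i)) ℝ)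
    (B : Matrix (R → Bool) (R → Bool) ℝ) :
    (angCliqueOp i A ⊗ₖ B).submatrix (embC n R) (embC n R) =
      localOp (α := fun _ : L => Bool) i A.toBlocks₁₁ ⊗ₖ B := by
  ext p q
  simp [embC, localOp, toBlocks₁₁]

theorem one_kronecker_submatrix_embC (B : Matrix (R → Bool) (R → Bool) ℝ) :
    ((1 : Matrix (∀ i, CliqueIndex (n i)) (∀ i, CliqueIndex (n i)) ℝ) ⊗ₖ B).submatrix
      (embC n R) (embC n R) = (1 : Matrix (L → Bool) (L → Bool) ℝ) ⊗ₖ B := by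
  ext p q
  simp only [submatrix_apply, embC, kroneckerMap_apply, one_apply]
  congr 2
  simp [funext_iff]

theorem angCliqueOp_submatrix_embQ (k : ∀ i, Fin (n i - 1)) (i : L)
    (A : Matrix (CliqueIndex (n i)) (CliqueIndex (n i)) ℝ) (B : Matrix (R → Bool) (R → Bool) ℝ) :
    (angCliqueOp i A ⊗ₖ B).submatrix (embQ R k) (embQ R k) =
      A (Sum.inr (k i)) (Sum.inr (k i)) • B := by
  ext p q
  simp [embQ, localOp]

theorem one_kronecker_submatrix_embQ (k : ∀ i, Fin (n i - 1))
    (B : Matrix (R → Bool) (R → Bool) ℝ) :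
    ((1 : Matrix (∀ i, CliqueIndex (n i)) (∀ i, CliqueIndex (n i)) ℝ) ⊗ₖ B).submatrix
      (embQ R k) (embQ R k) = B := by
  ext p q
  simp [embQ]

theorem sectorH_submatrix_embC (K : StructureKind n) (wL : L → ℝ) (wR : R → ℝ) (Jzz x jxx : ℝ) :
    (sectorH K wL wR Jzz x jxx).submatrix (embC n R) (embC n R) = blockC K wL wR Jzz x jxx := by
  simp only [sectorH, blockC, submatrix_add, submatrix_smul, Pi.add_apply, Pi.smul_apply,
    submatrix_sum, angCliqueOp_submatrix_embC, one_kronecker_submatrix_embC, cliqueBlockH,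
    cliqueCouplingDiag, toBlocks_fromBlocks₁₁, localOp_smul, smul_kronecker]

theorem sectorH_submatrix_embQ {K : StructureKind n} {k : ∀ i, Fin (n i - 1)} (hk : K.IsQ k)
    (wL : L → ℝ) (wR : R → ℝ) (Jzz x jxx : ℝ) :
    (sectorH K wL wR Jzz x jxx).submatrix (embQ R k) (embQ R k) = blockQ K wL wR Jzz x jxx := by
  have h : ∀ w c, twoLevel (w - c) x = twoLevel w x + c • shiftedZ := by
    intro w c
    rw [twoLevel_eq, twoLevel_eq]
    module
  simp only [sectorH, blockQ, submatrix_add, submatrix_smul, Pi.add_apply, Pi.smul_apply,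
    submatrix_sum, angCliqueOp_submatrix_embQ, one_kronecker_submatrix_embQ, cliqueBlockH,
    cliqueCouplingDiag, fromBlocks_apply₂₂, diagonal_apply_eq, K.spinZeroCoeff_of_isQ hk, h,
    localOp_add, localOp_smul, Matrix.smul_apply, one_apply_eq, smul_eq_mul, mul_one, siteOp,
    mul_smul]
  rw [← Finset.sum_smul, Finset.sum_neg_distrib, Finset.sum_comm, add_assoc,
    Finset.sum_add_distrib (f := fun j : R => localOp (α := fun _ : R => Bool) j
      (twoLevel (wR j) x))]
  simp only [← Finset.sum_smul, ← Finset.smul_sum]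

/-! ### The signs of the amplitudes -/

theorem SpinZeroFrame.exists_neg_pos {m : ℕ} (F : SpinZeroFrame m) (k : Fin (m - 1)) :
    (∃ a, F.amp k a < 0) ∧ ∃ a, 0 < F.amp k a := by
  have hne : ∃ a ∈ Finset.univ, F.amp k a ≠ 0 := by
    by_contra! h
    have h1 := F.orthonormal k k
    simp [h] at h1
  obtain ⟨a, -, ha⟩ := Finset.exists_pos_of_sum_zero_of_exists_nonzero _ (F.sum_zero k) hne
  have hsum : ∑ a, -F.amp k a = 0 := by rw [Finset.sum_neg_distrib, F.sum_zero, neg_zero]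
  obtain ⟨b, -, hb⟩ := Finset.exists_pos_of_sum_zero_of_exists_nonzero (s := Finset.univ)
    (fun a => -F.amp k a) hsum (by simpa using hne)
  exact ⟨⟨b, by linarith⟩, ⟨a, ha⟩⟩

theorem singletonState_lowConfig_some {m : ℕ} (f : Fin m → ℝ) (a : Fin m) :
    singletonState f (lowConfig (some a)) = f a := by
  simp [singletonState_eq, lowConfig_injective.eq_iff]

theorem cliqueU_inl_nonneg {m : ℕ} (F : SpinZeroFrame m) (c : Fin m → Bool) (b : Bool) :
    0 ≤ cliqueU F c (Sum.inl b) := by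
  cases b
  · change 0 ≤ if _ then (1 : ℝ) else 0
    split_ifs <;> norm_num
  · change 0 ≤ singletonState _ c
    rw [singletonState_eq]
    refine Finset.sum_nonneg fun a _ => ?_
    split_ifs <;> positivity

theorem exists_cliqueU_pos {m : ℕ} (hm : 1 ≤ m) (F : SpinZeroFrame m) (p : CliqueIndex m) :
    ∃ c, 0 < cliqueU F c p := by
  rcases p with (_ | _) | k
  · exact ⟨fun _ => false, by simp [cliqueU]⟩
  · refine ⟨lowConfig (some ⟨0, hm⟩), ?_⟩
    have h0 : (0 : ℝ) < m := by exact_mod_cast hm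
    change 0 < singletonState _ _
    rw [singletonState_lowConfig_some]
    positivity
  · obtain ⟨a, ha⟩ := (F.exists_neg_pos k).2
    exact ⟨lowConfig (some a), ha.trans_eq (singletonState_lowConfig_some _ a).symm⟩

theorem exists_cliqueU_inr_neg {m : ℕ} (F : SpinZeroFrame m) (k : Fin (m - 1)) :
    ∃ c, cliqueU F c (Sum.inr k) < 0 := by
  obtain ⟨a, ha⟩ := (F.exists_neg_pos k).1
  exact ⟨lowConfig (some a), (singletonState_lowConfig_some _ a).trans_lt ha⟩

theorem isSameSign_angU (F : ∀ i, SpinZeroFrame (n i)) {p : AngIndex n R}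
    (hp : sector p = sectorC n) : IsSameSign fun c => angU R F c p := by
  intro c
  refine mul_nonneg (Finset.prod_nonneg fun i _ => ?_) (by split_ifs <;> norm_num)
  have hi : cliqueSector (p.1 i) = none := congrFun hp i
  rcases h : p.1 i with b | k
  · exact cliqueU_inl_nonneg _ _ _
  · rw [h] at hi
    cases hi

theorem exists_inr_of_sector_ne {p : AngIndex n R} (hp : sector p ≠ sectorC n) :
    ∃ i k, p.1 i = Sum.inr k := by
  by_contra! h
  refine hp (funext fun i => ?_)
  rcases hi : p.1 i with b | k
  · simp [sector, hi, cliqueSector, sectorC]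
  · exact absurd hi (h i k)

/-- All cliques but one are given a configuration of positive amplitude; the remaining one carries a
spin-zero state, whose amplitudes take both signs. -/
theorem isOppositeSign_angU (hn : ∀ i, 1 ≤ n i) (F : ∀ i, SpinZeroFrame (n i)) {p : AngIndex n R}
    (hp : sector p ≠ sectorC n) : IsOppositeSign fun c => angU R F c p := by
  obtain ⟨i, k, hi⟩ := exists_inr_of_sector_ne hp
  choose c hc using fun u => exists_cliqueU_pos (hn u) (F u) (p.1 u)
  obtain ⟨d, hd⟩ := exists_cliqueU_inr_neg (F i) k
  rw [← hi] at hd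
  have hval : ∀ z : ∀ u, Fin (n u) → Bool,
      angU R F ((configEquiv n R).symm (z, p.2)) p = ∏ u, cliqueU (F u) (z u) (p.1 u) := by
    intro z
    rw [angU_eq]
    simp [tensorMatrix]
  refine ⟨(configEquiv n R).symm (c, p.2),
    (configEquiv n R).symm (Function.update c i d, p.2), ?_, ?_⟩
  · simp only [hval]
    exact Finset.prod_pos fun u _ => hc u
  · simp only [hval]
    rw [← Finset.mul_prod_erase _ _ (Finset.mem_univ i), Function.update_self]
    refine mul_neg_of_neg_of_pos hd (Finset.prod_pos fun u hu => ?_)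
    rw [Function.update_of_ne (Finset.ne_of_mem_erase hu)]
    exact hc u

end Blocks

/-! ### Ground states for a large transverse field -/

section Perturbation

variable {ι : Type*} [Fintype ι]

theorem exists_abs_dotProduct_mulVec_le (B : Matrix ι ι ℝ) :
    ∃ M : ℝ, ∀ φ : ι → ℝ, |φ ⬝ᵥ (B *ᵥ φ)| ≤ M * (φ ⬝ᵥ φ) := by
  refine ⟨∑ i, ∑ j, |B i j|, fun φ => ?_⟩
  have h1 : ∀ i, φ i ^ 2 ≤ φ ⬝ᵥ φ := by
    intro i
    rw [sq]
    exact Finset.single_le_sum (f := fun i => φ i * φ i) (fun j _ => mul_self_nonneg _)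
      (Finset.mem_univ i)
  have h2 : φ ⬝ᵥ (B *ᵥ φ) = ∑ i, ∑ j, B i j * (φ i * φ j) := by
    simp only [dotProduct, mulVec, Finset.mul_sum]
    exact Finset.sum_congr rfl fun i _ => Finset.sum_congr rfl fun j _ => by ring
  rw [h2, Finset.sum_mul]
  refine (Finset.abs_sum_le_sum_abs _ _).trans (Finset.sum_le_sum fun i _ => ?_)
  rw [Finset.sum_mul]
  refine (Finset.abs_sum_le_sum_abs _ _).trans (Finset.sum_le_sum fun j _ => ?_)
  rw [abs_mul]
  refine mul_le_mul_of_nonneg_left (abs_le.2 ⟨?_, ?_⟩) (abs_nonneg _)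
  · nlinarith [h1 i, h1 j, sq_nonneg (φ i + φ j)]
  · nlinarith [h1 i, h1 j, sq_nonneg (φ i - φ j)]

/-- If the quadratic form of `A` attains its lower bound `-g` at some vector, and costs at least `δ`
more outside `S`, then the ground states of `x A + B` concentrate on `S` as `x → ∞`. -/
theorem eventually_groundState_concentrates (A B : Matrix ι ι ℝ) (S : ι → Prop)
    [DecidablePred S] {g δ : ℝ} (hδ : 0 < δ)
    (hA : ∀ φ : ι → ℝ, -g * (φ ⬝ᵥ φ) + δ * ∑ p with ¬S p, φ p ^ 2 ≤ φ ⬝ᵥ (A *ᵥ φ))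
    {χ : ι → ℝ} (hχ : χ ≠ 0) (hAχ : χ ⬝ᵥ (A *ᵥ χ) ≤ -g * (χ ⬝ᵥ χ)) {ε : ℝ} (hε : 0 < ε) :
    ∀ᶠ x : ℝ in atTop, ∀ ψ : ι → ℝ, IsGroundState (x • A + B) ψ →
      ∑ p with ¬S p, ψ p ^ 2 ≤ ε * ∑ p, ψ p ^ 2 := by
  obtain ⟨M, hM⟩ := exists_abs_dotProduct_mulVec_le B
  have hχ0 : 0 < χ ⬝ᵥ χ :=
    lt_of_le_of_ne (Finset.sum_nonneg fun i _ => mul_self_nonneg _)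
      fun h => hχ (dotProduct_self_eq_zero.1 h.symm)
  have hform : ∀ (x : ℝ) (φ : ι → ℝ), φ ⬝ᵥ ((x • A + B) *ᵥ φ) =
      x * (φ ⬝ᵥ (A *ᵥ φ)) + φ ⬝ᵥ (B *ᵥ φ) := by
    intro x φ
    rw [add_mulVec, smul_mulVec, dotProduct_add, dotProduct_smul, smul_eq_mul]
  filter_upwards [eventually_gt_atTop 0, eventually_ge_atTop (2 * M / (δ * ε))] with x hx0 hxM
  rintro ψ ⟨-, E, hE, hmin⟩
  have hsq : ∑ p, ψ p ^ 2 = ψ ⬝ᵥ ψ := Finset.sum_congr rfl fun p _ => sq _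
  rw [hsq]
  have hψ0 : 0 ≤ ψ ⬝ᵥ ψ := Finset.sum_nonneg fun i _ => mul_self_nonneg _
  -- the trial vector bounds the ground energy from above
  have hE1 : E ≤ -x * g + M := by
    refine le_of_mul_le_mul_right ?_ hχ0
    have h1 := hmin χ
    rw [hform] at h1
    have h2 := (abs_le.1 (hM χ)).2
    nlinarith [mul_le_mul_of_nonneg_left hAχ hx0.le]
  have hE2 : E * (ψ ⬝ᵥ ψ) = x * (ψ ⬝ᵥ (A *ᵥ ψ)) + ψ ⬝ᵥ (B *ᵥ ψ) := by
    rw [← hform, hE, dotProduct_smul, smul_eq_mul]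
  have h3 := (abs_le.1 (hM ψ)).1
  have h4 := mul_le_mul_of_nonneg_left (hA ψ) hx0.le
  have h5 := mul_le_mul_of_nonneg_right hE1 hψ0
  have h6 : x * δ * ∑ p with ¬S p, ψ p ^ 2 ≤ 2 * M * (ψ ⬝ᵥ ψ) := by linarith
  have h7 : 2 * M ≤ x * (δ * ε) := (div_le_iff₀ (mul_pos hδ hε)).1 hxM
  have h8 := mul_le_mul_of_nonneg_right h7 hψ0
  refine le_of_mul_le_mul_left ?_ (mul_pos hx0 hδ)
  linarith

/-- The part of a ground state outside a union of blocks is itself an eigenvector. -/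
theorem IsGroundState.indicator {H : Matrix ι ι ℝ} {S : ι → Prop} [DecidablePred S]
    (hH : ∀ p q, ¬(S p ↔ S q) → H p q = 0) {ψ : ι → ℝ} (hψ : IsGroundState H ψ)
    (hne : (fun p => if S p then 0 else ψ p) ≠ 0) :
    IsGroundState H fun p => if S p then 0 else ψ p := by
  obtain ⟨-, E, hE, hmin⟩ := hψ
  refine ⟨hne, E, funext fun p => ?_, hmin⟩
  have hp : ∑ q, H p q * ψ q = E * ψ p := congrFun hE p
  change ∑ q, H p q * (if S q then 0 else ψ q) = E * (if S p then 0 else ψ p)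
  by_cases h : S p
  · rw [if_pos h, mul_zero]
    refine Finset.sum_eq_zero fun q _ => ?_
    split_ifs with hq
    · exact mul_zero _
    · rw [hH p q (by tauto), zero_mul]
  · rw [if_neg h, ← hp]
    refine Finset.sum_congr rfl fun q _ => ?_
    split_ifs with hq
    · rw [hH p q (by tauto), zero_mul, zero_mul]
    · rfl

theorem dotProduct_mulVec_nonneg_of_idempotent {Q : Matrix ι ι ℝ} (hT : Qᵀ = Q) (hQ : Q * Q = Q)
    (φ : ι → ℝ) : 0 ≤ φ ⬝ᵥ (Q *ᵥ φ) := by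
  have h : φ ⬝ᵥ (Q *ᵥ φ) = (Q *ᵥ φ) ⬝ᵥ (Q *ᵥ φ) := by
    conv_lhs => rw [← hQ, ← mulVec_mulVec, dotProduct_mulVec, ← mulVec_transpose, hT]
  rw [h]
  exact Finset.sum_nonneg fun i _ => mul_self_nonneg _

end Perturbation

section GroundState

variable {L R : Type*} [Fintype L] [DecidableEq L] [Fintype R] [DecidableEq R] {n : L → ℕ}

/-- The projector onto the span of `|1⟩ - |0⟩`, the excited state of the transverse field `-Sˣ`. -/
def minusProj : Matrix Bool Bool ℝ := (1 / 2 : ℝ) • 1 - spinX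

theorem minusProj_transpose : minusProjᵀ = minusProj := by
  ext a b
  cases a <;> cases b <;> simp [minusProj, spinX_apply]

theorem minusProj_mul_self : minusProj * minusProj = minusProj := by
  ext a b
  cases a <;> cases b <;> simp [minusProj, spinX_apply, mul_apply] <;> norm_num

/-- The projector onto the excited state of the effective spin one half of a clique. -/
def cliqueMinusProj (m : ℕ) : Matrix (CliqueIndex m) (CliqueIndex m) ℝ :=
  fromBlocks minusProj 0 0 0

/-- The largest eigenvalue of `∑ Sˣ` on the sector of `p`: an effective spin one half in clique `i`
contributes `√(n i) / 2`, a spin-zero state nothing, and every vertex of `R` one half. -/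
def fieldStrength (p : AngIndex n R) : ℝ :=
  1 / 2 * ((∑ i, if (p.1 i).isLeft then √(n i : ℝ) else 0) + Fintype.card R)

theorem angConj_transverseH_eq (hn : ∀ i, 1 ≤ n i) (F : ∀ i, SpinZeroFrame (n i)) :
    angConj F (transverseH n R) =
      (∑ i, √(n i : ℝ) • (angCliqueOp i (cliqueMinusProj (n i)) ⊗ₖ (1 : Matrix (R → Bool) _ ℝ))
        + ∑ j, (1 : Matrix (∀ i, CliqueIndex (n i)) (∀ i, CliqueIndex (n i)) ℝ)
          ⊗ₖ siteOp j minusProj)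
        - diagonal fieldStrength := by
  have h1 : ∀ i, fromBlocks (√(n i : ℝ) • spinX) 0 0 (0 : Matrix (Fin (n i - 1)) _ ℝ) =
      √(n i : ℝ) • ((1 / 2 : ℝ) • diagonal (fun p : CliqueIndex (n i) => if p.isLeft then 1 else 0)
        - cliqueMinusProj (n i)) := by
    intro i
    ext p q
    rcases p with a | k <;> rcases q with b | l <;>
      simp [cliqueMinusProj, minusProj, diagonal_apply, one_apply]
  have h2 : ∀ j : R, siteOp j spinX = (1 / 2 : ℝ) • 1 - siteOp j minusProj := by
    intro j
    have h : spinX = (1 / 2 : ℝ) • diagonal (fun _ => 1) + -minusProj := by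
      rw [diagonal_one, minusProj]
      abel
    rw [siteOp, h, localOp_add, localOp_neg, localOp_smul, localOp_diagonal, diagonal_one,
      sub_eq_add_neg]
  have h3 : diagonal (fieldStrength (n := n) (R := R)) =
      ∑ i, √(n i : ℝ) • (1 / 2 : ℝ) • (angCliqueOp i (diagonal fun p : CliqueIndex (n i) =>
          if p.isLeft then (1 : ℝ) else 0) ⊗ₖ (1 : Matrix (R → Bool) (R → Bool) ℝ))
        + ∑ _j : R, (1 / 2 : ℝ) • (1 : Matrix (AngIndex n R) (AngIndex n R) ℝ) := by
    simp only [angCliqueOp, localOp_diagonal, ← diagonal_one, diagonal_kronecker_diagonal,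
      ← diagonal_smul, Finset.sum_const, Finset.card_univ]
    ext p q
    by_cases hpq : p = q
    · subst hpq
      simp [Matrix.sum_apply, fieldStrength, mul_add, Finset.mul_sum]
      exact Finset.sum_congr rfl fun i _ => by rw [mul_comm]
    · simp [Matrix.sum_apply, hpq]
  rw [angConj_transverseH hn, h3]
  simp only [h1, h2, angCliqueOp, localOp_smul, sub_eq_add_neg, localOp_add, localOp_neg,
    smul_add, smul_neg, add_kronecker, kronecker_add, neg_kronecker, kronecker_neg, smul_kronecker,
    kronecker_smul, one_kronecker_one, Finset.sum_add_distrib, Finset.sum_neg_distrib]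
  abel

/-- The indicator of the same-sign sector: it is proportional to the product of the
ground states of the transverse field on the effective spins and on `R`. -/
def uniformC (n : L → ℕ) (R : Type*) : AngIndex n R → ℝ :=
  fun p => if ∀ i, (p.1 i).isLeft then 1 else 0

theorem sector_eq_sectorC_iff {p : AngIndex n R} :
    sector p = sectorC n ↔ ∀ i, (p.1 i).isLeft := by
  rw [funext_iff]
  refine forall_congr' fun i => ?_
  rw [sector, sectorC]
  rcases p.1 i with b | k <;> simp [cliqueSector]

theorem uniformC_ne_zero : uniformC n R ≠ 0 := fun h => by
  have := congrFun h (fun _ => Sum.inl true, fun _ => true)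
  simp [uniformC] at this

theorem uniformC_cliqueMinusProj (i : L) :
    (angCliqueOp i (cliqueMinusProj (n i)) ⊗ₖ (1 : Matrix (R → Bool) (R → Bool) ℝ)) *ᵥ
      uniformC n R = 0 := by
  funext p
  have h : ((angCliqueOp i (cliqueMinusProj (n i)) ⊗ₖ (1 : Matrix (R → Bool) (R → Bool) ℝ)) *ᵥ
      uniformC n R) p = (angCliqueOp i (cliqueMinusProj (n i)) *ᵥ
        fun a => uniformC n R (a, p.2)) p.1 := by
    simp [mulVec, dotProduct, Fintype.sum_prod_type, one_apply]
  rw [h, localOp_mulVec, Fintype.sum_sum_type, Fintype.sum_bool]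
  have hu : uniformC n R (Function.update p.1 i (Sum.inl true), p.2) =
      uniformC n R (Function.update p.1 i (Sum.inl false), p.2) := by
    refine ite_congr_prop (forall_congr' fun u => ?_) _ _
    obtain rfl | hu := eq_or_ne u i
    · simp
    · simp [Function.update_of_ne hu]
  rw [hu, ← add_mul]
  have h0 : cliqueMinusProj (n i) (p.1 i) (Sum.inl true) +
      cliqueMinusProj (n i) (p.1 i) (Sum.inl false) = 0 := by
    rcases p.1 i with (_ | _) | k <;> simp [cliqueMinusProj, minusProj, spinX_apply]
  have h0' : ∀ k, cliqueMinusProj (n i) (p.1 i) (Sum.inr k) = 0 := by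
    intro k
    rcases p.1 i with (_ | _) | l <;> simp [cliqueMinusProj]
  simp [h0, h0']

theorem uniformC_minusProj (j : R) :
    ((1 : Matrix (∀ i, CliqueIndex (n i)) (∀ i, CliqueIndex (n i)) ℝ) ⊗ₖ siteOp j minusProj) *ᵥ
      uniformC n R = 0 := by
  funext p
  have h : (((1 : Matrix (∀ i, CliqueIndex (n i)) (∀ i, CliqueIndex (n i)) ℝ) ⊗ₖ
      siteOp j minusProj) *ᵥ uniformC n R) p =
        (siteOp j minusProj *ᵥ fun b => uniformC n R (p.1, b)) p.2 := by
    simp [mulVec, dotProduct, Fintype.sum_prod_type, one_apply]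
  have hu : ∀ b, uniformC n R (p.1, b) = uniformC n R p := fun b => rfl
  rw [h, localOp_mulVec, Fintype.sum_bool]
  simp only [hu]
  rw [← add_mul]
  have h0 : minusProj (p.2 j) true + minusProj (p.2 j) false = 0 := by
    rcases p.2 j with _ | _ <;> simp [minusProj, spinX_apply]
  rw [h0, zero_mul, Pi.zero_apply]

/-- On the same-sign sector the field strength is maximal; every spin-zero state lowers it by at
least one half. -/
theorem fieldStrength_le (hn : ∀ i, 1 ≤ n i) {p : AngIndex n R} (hp : sector p ≠ sectorC n) :
    fieldStrength p + 1 / 2 ≤ 1 / 2 * ((∑ i, √(n i : ℝ)) + Fintype.card R) := by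
  obtain ⟨i, k, hi⟩ := exists_inr_of_sector_ne hp
  have h1 : (1 : ℝ) ≤ √(n i : ℝ) := Real.one_le_sqrt.2 (by exact_mod_cast hn i)
  have h2 : ∑ u ∈ Finset.univ.erase i, (if (p.1 u).isLeft then √(n u : ℝ) else 0) ≤
      ∑ u ∈ Finset.univ.erase i, √(n u : ℝ) := by
    refine Finset.sum_le_sum fun u _ => ?_
    split_ifs
    · exact le_rfl
    · exact Real.sqrt_nonneg _
  rw [fieldStrength, ← Finset.add_sum_erase _ _ (Finset.mem_univ i),
    ← Finset.add_sum_erase _ (fun i => √(n i : ℝ)) (Finset.mem_univ i)]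
  simp only [hi, Sum.isLeft_inr, Bool.false_eq_true, if_false]
  linarith

theorem fieldStrength_of_sector_eq {p : AngIndex n R} (hp : sector p = sectorC n) :
    fieldStrength p = 1 / 2 * ((∑ i, √(n i : ℝ)) + Fintype.card R) := by
  simp [fieldStrength, sector_eq_sectorC_iff.1 hp]

/-- The transverse-field term is minus the field strength plus non-negative multiples of projectors,
so minus the field strength bounds its quadratic form from below. -/
theorem transverse_lower_bound (hn : ∀ i, 1 ≤ n i) (F : ∀ i, SpinZeroFrame (n i))
    (φ : AngIndex n R → ℝ) :
    -(1 / 2 * ((∑ i, √(n i : ℝ)) + Fintype.card R)) * (φ ⬝ᵥ φ) +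
        1 / 2 * ∑ p with ¬sector p = sectorC n, φ p ^ 2 ≤
      φ ⬝ᵥ (angConj F (transverseH n R) *ᵥ φ) := by
  have hM : ∀ m, cliqueMinusProj m * cliqueMinusProj m = cliqueMinusProj m := by
    intro m
    simp [cliqueMinusProj, fromBlocks_multiply, minusProj_mul_self]
  have hM' : ∀ m, (cliqueMinusProj m)ᵀ = cliqueMinusProj m := by
    intro m
    simp [cliqueMinusProj, fromBlocks_transpose, minusProj_transpose]
  have h1 : ∀ i, 0 ≤ φ ⬝ᵥ ((angCliqueOp i (cliqueMinusProj (n i)) ⊗ₖ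
      (1 : Matrix (R → Bool) (R → Bool) ℝ)) *ᵥ φ) := by
    intro i
    refine dotProduct_mulVec_nonneg_of_idempotent ?_ ?_ φ
    · rw [← kroneckerMap_transpose, angCliqueOp, localOp_transpose, hM', transpose_one]
    · rw [← mul_kronecker_mul, localOp_mul, hM, Matrix.one_mul]
  have h2 : ∀ j, 0 ≤ φ ⬝ᵥ (((1 : Matrix (∀ i, CliqueIndex (n i)) (∀ i, CliqueIndex (n i)) ℝ) ⊗ₖ
      siteOp j minusProj) *ᵥ φ) := by
    intro j
    refine dotProduct_mulVec_nonneg_of_idempotent ?_ ?_ φ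
    · rw [← kroneckerMap_transpose, siteOp, localOp_transpose, minusProj_transpose, transpose_one]
    · rw [← mul_kronecker_mul, localOp_mul, minusProj_mul_self, Matrix.one_mul]
  have h3 : φ ⬝ᵥ (diagonal fieldStrength *ᵥ φ) = ∑ p, fieldStrength p * φ p ^ 2 := by
    simp only [dotProduct, mulVec_diagonal]
    exact Finset.sum_congr rfl fun p _ => by ring
  have h4 : ∑ p, fieldStrength p * φ p ^ 2 + 1 / 2 * ∑ p with ¬sector p = sectorC n, φ p ^ 2 ≤
      1 / 2 * ((∑ i, √(n i : ℝ)) + Fintype.card R) * (φ ⬝ᵥ φ) := by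
    rw [Finset.sum_filter, dotProduct, Finset.mul_sum, Finset.mul_sum, ← Finset.sum_add_distrib]
    refine Finset.sum_le_sum fun p _ => ?_
    split_ifs with hp
    · rw [fieldStrength_of_sector_eq hp]
      exact le_of_eq (by ring)
    · nlinarith [mul_le_mul_of_nonneg_right (fieldStrength_le hn hp) (sq_nonneg (φ p))]
  rw [angConj_transverseH_eq hn]
  simp only [sub_mulVec, add_mulVec, sum_mulVec, smul_mulVec, dotProduct_sub, dotProduct_add,
    dotProduct_sum, dotProduct_smul, smul_eq_mul, h3]
  have h5 := Finset.sum_nonneg fun i (_ : i ∈ Finset.univ) =>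
    mul_nonneg (Real.sqrt_nonneg (n i : ℝ)) (h1 i)
  have h6 := Finset.sum_nonneg fun j (_ : j ∈ Finset.univ) => h2 j
  linarith

theorem transverse_uniformC (hn : ∀ i, 1 ≤ n i) (F : ∀ i, SpinZeroFrame (n i)) :
    angConj F (transverseH n R) *ᵥ uniformC n R =
      (-(1 / 2 * ((∑ i, √(n i : ℝ)) + Fintype.card R))) • uniformC n R := by
  rw [angConj_transverseH_eq hn]
  simp only [sub_mulVec, add_mulVec, sum_mulVec, smul_mulVec, uniformC_cliqueMinusProj,
    uniformC_minusProj, smul_zero, Finset.sum_const_zero, add_zero, zero_sub]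
  funext p
  simp only [Pi.neg_apply, mulVec_diagonal, Pi.smul_apply, smul_eq_mul]
  by_cases hp : sector p = sectorC n
  · rw [fieldStrength_of_sector_eq hp]
    ring
  · have h0 : uniformC n R p = 0 := if_neg fun h => hp (sector_eq_sectorC_iff.2 h)
    simp [h0]

/-- The ground state concentrates on the same-sign sector, where the transverse field attains its
minimum. -/
theorem eventually_groundState_angH (hn : ∀ i, 1 ≤ n i) (F : ∀ i, SpinZeroFrame (n i))
    (K : StructureKind n) (wL : L → ℝ) (wR : R → ℝ) (Jclique Jzz jxx : ℝ) {ε : ℝ} (hε : 0 < ε) :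
    ∀ᶠ x : ℝ in atTop, ∀ ψ : AngIndex n R → ℝ,
      IsGroundState (angH F K wL wR Jclique Jzz x jxx) ψ →
        ∑ p with sector p ≠ sectorC n, ψ p ^ 2 ≤ ε * ∑ p, ψ p ^ 2 := by
  have h : ∀ x, angH F K wL wR Jclique Jzz x jxx = x • angConj F (transverseH n R) +
      (jxx • angConj F (driverH n R) + angConj F (problemH K wL wR Jclique Jzz)) := by
    intro x
    rw [angH_eq hn, systemH, map_add, map_add, map_smul, map_smul, add_assoc]
  simp only [h]
  refine eventually_groundState_concentrates _ _ (fun p => sector p = sectorC n)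
    (g := 1 / 2 * ((∑ i, √(n i : ℝ)) + Fintype.card R)) one_half_pos
    (transverse_lower_bound hn F) uniformC_ne_zero ?_ hε
  rw [transverse_uniformC hn, dotProduct_smul, smul_eq_mul]

/-- Without an inter-block term the part of a ground state outside the same-sign sector would be a
ground state by itself, which contradicts the concentration of ground states. -/
theorem eventually_groundState_angH_dis (hn : ∀ i, 1 ≤ n i) (F : ∀ i, SpinZeroFrame (n i))
    (wL : L → ℝ) (wR : R → ℝ) (Jclique Jzz jxx : ℝ) :
    ∀ᶠ x : ℝ in atTop, ∀ ψ : AngIndex n R → ℝ,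
      IsGroundState (angH F .dis wL wR Jclique Jzz x jxx) ψ →
        ∀ p, sector p ≠ sectorC n → ψ p = 0 := by
  filter_upwards [eventually_groundState_angH hn F .dis wL wR Jclique Jzz jxx one_half_pos]
    with x hx ψ hψ p hp
  by_contra hne
  have hH : ∀ p q, ¬(sector p = sectorC n ↔ sector q = sectorC n) →
      angH F .dis wL wR Jclique Jzz x jxx p q = 0 := by
    intro p q hpq
    rw [angH_eq_sectorH_add_interBlock hn .dis F trivial]
    exact (add_zero _).trans (isBlockDiagonal_sectorH _ _ _ _ _ _ p q
      fun h => hpq (by rw [h]))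
  have h1 := hx _ (hψ.indicator (S := fun p => sector p = sectorC n) hH
    fun h0 => hne (by simpa [hp] using congrFun h0 p))
  have h2 : ∑ p with sector p ≠ sectorC n, (if sector p = sectorC n then 0 else ψ p) ^ 2 =
      ∑ p, (if sector p = sectorC n then 0 else ψ p) ^ 2 := by
    rw [Finset.sum_filter]
    refine Finset.sum_congr rfl fun q _ => ?_
    by_cases hq : sector q = sectorC n <;> simp [hq]
  rw [h2] at h1
  have h3 : ψ p ^ 2 ≤ ∑ p, (if sector p = sectorC n then 0 else ψ p) ^ 2 := by
    have := Finset.single_le_sum (f := fun p => (if sector p = sectorC n then 0 else ψ p) ^ 2)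
      (fun q _ => sq_nonneg _) (Finset.mem_univ p)
    simpa [hp] using this
  have h4 : 0 < ψ p ^ 2 := by positivity
  linarith

end GroundState

end

theorem mainTheorem1 {L R : Type*} [Fintype L] [DecidableEq L] [Fintype R] [DecidableEq R]
    (n : L → ℕ) (hn : ∀ i, 1 ≤ n i) (K : StructureKind n)
    (F : ∀ i, SpinZeroFrame (n i)) (hF : K.Admits F)
    (wL : L → ℝ) (wR : R → ℝ) (Jclique Jzz : ℝ) :
    -- the angular-momentum basis is an orthonormal basis of the low-energy subspace
    ((angU R F)ᵀ * angU R F = 1 ∧ angU R F * (angU R F)ᵀ = lowProjector n R) ∧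
    -- it consists of same-sign states in the sector C, of opposite-sign states in all others
    (∀ p : AngIndex n R, (sector p = sectorC n → IsSameSign fun c => angU R F c p) ∧
      (sector p ≠ sectorC n → IsOppositeSign fun c => angU R F c p)) ∧
    -- the block structure
    (∀ x jxx : ℝ, ∃ D : Matrix (AngIndex n R) (AngIndex n R) ℝ,
      IsBlockDiagonal D ∧
      angH F K wL wR Jclique Jzz x jxx = D + interBlock R K Jzz ∧
      D.submatrix (embC n R) (embC n R) = blockC K wL wR Jzz x jxx ∧
      ∀ k : ∀ i, Fin (n i - 1), K.IsQ k →
        D.submatrix (embQ R k) (embQ R k) = blockQ K wL wR Jzz x jxx) ∧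
    -- the inter-block term has no entries inside a block
    (∀ p q : AngIndex n R, sector p = sector q → interBlock R K Jzz p q = 0) ∧
    -- the ground state at the beginning of Stage 1, for a large transverse field `Γ₁`
    (∀ Jxx : ℝ,
      (K = .dis → ∀ᶠ Γ₁ : ℝ in atTop, ∀ ψ : AngIndex n R → ℝ,
        IsGroundState (angH F K wL wR Jclique Jzz Γ₁ Jxx) ψ →
          ∀ p, sector p ≠ sectorC n → ψ p = 0) ∧
      (∀ ε : ℝ, 0 < ε → ∀ᶠ Γ₁ : ℝ in atTop, ∀ ψ : AngIndex n R → ℝ,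
        IsGroundState (angH F K wL wR Jclique Jzz Γ₁ Jxx) ψ →
          ∑ p with sector p ≠ sectorC n, ψ p ^ 2 ≤ ε * ∑ p, ψ p ^ 2)) := by
  refine ⟨⟨angU_transpose_mul hn F, angU_mul_transpose hn F⟩,
    fun p => ⟨isSameSign_angU F, isOppositeSign_angU hn F⟩, fun x jxx => ?_,
    fun p q h => interBlock_apply_of_sector_eq K Jzz h, fun Jxx => ⟨?_, fun ε hε => ?_⟩⟩
  · exact ⟨sectorH K wL wR Jzz x jxx, isBlockDiagonal_sectorH K wL wR Jzz x jxx,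
      angH_eq_sectorH_add_interBlock hn K F hF wL wR Jclique Jzz x jxx,
      sectorH_submatrix_embC K wL wR Jzz x jxx,
      fun k hk => sectorH_submatrix_embQ hk wL wR Jzz x jxx⟩
  · rintro rfl
    exact eventually_groundState_angH_dis hn F wL wR Jclique Jzz Jxx
  · exact eventually_groundState_angH hn F K wL wR Jclique Jzz Jxx hε
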